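/- Let $q,\gamma\in\mathbb R$ with $q\neq 0$ and $\gamma\neq -1$; if $q<0$, assume also $\frac1q\neq\gamma+1$. For a Lebesgue-measurable $f$ on $\mathbb R_+=(0,\infty)$ put $$(Q_qf)(t)=t^{-1/q}\int_t^\infty f(s)\,s^{\frac1q-1}\,ds ,\qquad t>0 .$$ For $i=1,2$ let $\Phi_i(x)=\int_0^x\phi_i(s)\,ds$ be a Young function, that is, $\phi_i:\mathbb R_+\to\mathbb R$ is nondecreasing with $\phi_i(0^+)=0$ and $\lim_{s\to\infty}\phi_i(s)=\infty$; put $\Phi_i(\infty)=\infty$. Let $\Psi_i(x)=\int_0^x\phi_i^{-1}(s)\,ds$ be the complementary function, where $\phi_i^{-1}(s)=\inf\{t>0:\phi_i(t)\ge s\}$. For measurable $f$ on $\mathbb R_+$ let $$\rho^{(1)}_{\Phi_i,t^\gamma}(f)=\inf\Big\{\lambda>0:\int_0^\infty\Phi_i\Big(\frac{|f(t)|}{\lambda}\Big)t^\gamma\,dt\le 1\Big\}\in[0,\infty],$$ and let $L_{\Phi_i,t^\gamma}(\mathbb R_+)$ be the class of real-valued measurable $f$ on $\mathbb R_+$ with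 $\int_0^\infty\Phi_i(k|f(t)|)\,t^\gamma\,dt<\infty$ for some $k>0$. Put $\beta(t)=\int_t^\infty\Psi_2\big(s^{\frac1q-1-\gamma}\big)s^\gamma\,ds\in[0,\infty]$. Then the following are equivalent: 1. there is $L>0$ such that $\rho^{(1)}_{\Phi_1,t^\gamma}(Q_qf)\le L\,\rho^{(1)}_{\Phi_2,t^\gamma}(f)$ for all measurable $f:\mathbb R_+\to[0,\infty)$; 2. there is $K>0$ such that $\int_0^\infty\Phi_1\big((Q_qf)(t)\big)t^\gamma\,dt\le\int_0^\infty\Phi_2\big(Kf(s)\big)s^\gamma\,ds$ for all measurable $f:\mathbb R_+\to[0,\infty)$; 3. for every $f\in L_{\Phi_2,t^\gamma}(\mathbb R_+)$ the integral defining $(Q_qf)(t)$ converges absolutely for every $t>0$ and $Q_qf\in L_{\Phi_1,t^\gamma}(\mathbb R_+)$, and the map $Q_q:L_{\Phi_2,t^\gamma}(\mathbb R_+)\to L_{\Phi_1,t^\gamma}(\mathbb R_+)$ is continuous with respect to $\rho^{(1)}_{\Phi_2,t^\gamma}$ and $\rho^{(1)}_{\Phi_1,t^\gamma}$; 4. there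 is $C>0$ such that for all $t>0$ $$\int_0^t\Phi_1\Big(\frac{\beta(t)}{C s^{1/q}}\Big)s^\gamma\,ds\le\beta(t)<\infty ;$$ 5. there is $C>0$ such that for all $t>0$ $$\beta(t)<\infty\quad\text{and}\quad\int_0^t\phi_1\Big(\frac{\beta(t)}{C s^{1/q}}\Big)s^{\gamma-\frac1q}\,ds\le C .$$ -/

import Mathlib

open MeasureTheory Set Filter Topology
open scoped ENNReal NNReal

noncomputable section

/-- `φ` is the density of a Young function `Φ(x) = ∫₀ˣ φ`: it is nondecreasing on `(0, ∞)`,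
`φ(0⁺) = 0` and `φ(s) → ∞` as `s → ∞` (so `φ ≥ 0` on `(0, ∞)`). Values off `(0, ∞)` play no role. -/
structure IsYoungDensity (φ : ℝ → ℝ) : Prop where
  mono : MonotoneOn φ (Ioi 0)
  tendsto_zero : Tendsto φ (𝓝[>] 0) (𝓝 0)
  tendsto_top : Tendsto φ atTop atTop

/-- The function `Φ(x) = ∫₀ˣ φ(s) ds` on `[0, ∞]`; in particular `Φ(∞) = ∫₀^∞ φ(s) ds`, which is
`∞` for a Young density. -/
def youngFn (φ : ℝ → ℝ) (x : ℝ≥0∞) : ℝ≥0∞ :=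
  ∫⁻ s in {s : ℝ | 0 < s ∧ ENNReal.ofReal s < x}, ENNReal.ofReal (φ s)

/-- The generalized (left-continuous) inverse `φ⁻¹(s) = inf {t > 0 : s ≤ φ(t)}`. -/
def genInv (φ : ℝ → ℝ) (s : ℝ) : ℝ :=
  sInf {t : ℝ | 0 < t ∧ s ≤ φ t}

/-- The complementary function `Ψ(x) = ∫₀ˣ φ⁻¹(s) ds` of `Φ(x) = ∫₀ˣ φ(s) ds`. -/
def complFn (φ : ℝ → ℝ) (x : ℝ≥0∞) : ℝ≥0∞ :=
  youngFn (genInv φ) x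

/-- The modular `∫₀^∞ Φ(h(t)) t^γ dt` of a `[0, ∞]`-valued function `h` on `(0, ∞)`. -/
def modular (Φ : ℝ≥0∞ → ℝ≥0∞) (γ : ℝ) (h : ℝ → ℝ≥0∞) : ℝ≥0∞ :=
  ∫⁻ t in Ioi (0 : ℝ), Φ (h t) * ENNReal.ofReal (t ^ γ)

/-- The gauge norm `ρ⁽¹⁾(h) = inf {l > 0 : ∫₀^∞ Φ(h(t) / l) t^γ dt ≤ 1}`, with `inf ∅ = ∞`. -/
def gauge₁ (Φ : ℝ≥0∞ → ℝ≥0∞) (γ : ℝ) (h : ℝ → ℝ≥0∞) : ℝ≥0∞ :=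
  ⨅ (l : ℝ) (_ : 0 < l) (_ : modular Φ γ (fun t => h t / ENNReal.ofReal l) ≤ 1),
    ENNReal.ofReal l

/-- Membership of a real function on `(0, ∞)` in the Orlicz class `L_{Φ, t^γ}`: it is Lebesgue
measurable and `∫₀^∞ Φ(k |f(t)|) t^γ dt < ∞` for some `k > 0`. -/
def MemOrlicz (Φ : ℝ≥0∞ → ℝ≥0∞) (γ : ℝ) (f : ℝ → ℝ) : Prop :=
  AEMeasurable f (volume.restrict (Ioi 0)) ∧
    ∃ k : ℝ, 0 < k ∧ modular Φ γ (fun t => ENNReal.ofReal k * ‖f t‖ₑ) < ∞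

/-- `(Q_q f)(t) = t^{-1/q} ∫_t^∞ f(s) s^{1/q - 1} ds` for nonnegative `f`, with values in
`[0, ∞]`. -/
def hardyQ (q : ℝ) (f : ℝ → ℝ≥0) (t : ℝ) : ℝ≥0∞ :=
  ENNReal.ofReal (t ^ (-(1 / q))) *
    ∫⁻ s in Ioi t, (f s : ℝ≥0∞) * ENNReal.ofReal (s ^ (1 / q - 1))

/-- The integral defining `(Q_q f)(t)` converges absolutely for every `t > 0`. -/
def HardyQDefined (q : ℝ) (f : ℝ → ℝ) : Prop :=
  ∀ t : ℝ, 0 < t → IntegrableOn (fun s => f s * s ^ (1 / q - 1)) (Ioi t)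

/-- `(Q_q f)(t) = t^{-1/q} ∫_t^∞ f(s) s^{1/q - 1} ds` for real `f`; meaningful under
`HardyQDefined q f`. -/
def hardyQReal (q : ℝ) (f : ℝ → ℝ) (t : ℝ) : ℝ :=
  t ^ (-(1 / q)) * ∫ s in Ioi t, f s * s ^ (1 / q - 1)

/-- Norm inequality: `ρ⁽¹⁾_{Φ₁}(Q_q f) ≤ L ρ⁽¹⁾_{Φ₂}(f)` for all measurable `f ≥ 0`, with one
constant `L > 0`. -/
def GaugeIneq (q γ : ℝ) (Φ₁ Φ₂ : ℝ≥0∞ → ℝ≥0∞) : Prop :=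
  ∃ L : ℝ, 0 < L ∧ ∀ f : ℝ → ℝ≥0, AEMeasurable f (volume.restrict (Ioi 0)) →
    gauge₁ Φ₁ γ (hardyQ q f) ≤ ENNReal.ofReal L * gauge₁ Φ₂ γ (fun t => (f t : ℝ≥0∞))

/-- Modular inequality: `∫ Φ₁(Q_q f) t^γ dt ≤ ∫ Φ₂(K f) s^γ ds` for all measurable `f ≥ 0`, with
one constant `K > 0`. -/
def ModularIneq (q γ : ℝ) (Φ₁ Φ₂ : ℝ≥0∞ → ℝ≥0∞) : Prop :=
  ∃ K : ℝ, 0 < K ∧ ∀ f : ℝ → ℝ≥0, AEMeasurable f (volume.restrict (Ioi 0)) →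
    modular Φ₁ γ (hardyQ q f) ≤ modular Φ₂ γ (fun s => ENNReal.ofReal K * (f s : ℝ≥0∞))

/-- `Q_q` is defined on `L_{Φ₂, t^γ}`, maps it into `L_{Φ₁, t^γ}`, and is continuous for the
gauge norms `ρ⁽¹⁾`. -/
def ContinuousMapping (q γ : ℝ) (Φ₁ Φ₂ : ℝ≥0∞ → ℝ≥0∞) : Prop :=
  (∀ f : ℝ → ℝ, MemOrlicz Φ₂ γ f → HardyQDefined q f ∧ MemOrlicz Φ₁ γ (hardyQReal q f)) ∧
  ∀ f : ℝ → ℝ, MemOrlicz Φ₂ γ f → ∀ ε : ℝ≥0∞, 0 < ε → ∃ δ : ℝ≥0∞, 0 < δ ∧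
    ∀ g : ℝ → ℝ, MemOrlicz Φ₂ γ g →
      gauge₁ Φ₂ γ (fun t => ‖g t - f t‖ₑ) < δ →
        gauge₁ Φ₁ γ (fun t => ‖hardyQReal q g t - hardyQReal q f t‖ₑ) < ε

/-- `β(t) = ∫_t^∞ Ψ₂(s^{1/q - 1 - γ}) s^γ ds`. -/
def betaFn (q γ : ℝ) (Ψ₂ : ℝ≥0∞ → ℝ≥0∞) (t : ℝ) : ℝ≥0∞ :=
  ∫⁻ s in Ioi t, Ψ₂ (ENNReal.ofReal (s ^ (1 / q - 1 - γ))) * ENNReal.ofReal (s ^ γ)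

/-- First integral condition: `∫₀ᵗ Φ₁(β(t) / (C s^{1/q})) s^γ ds ≤ β(t) < ∞` for all `t > 0`, with
one constant `C > 0`. -/
def BKCond (q γ : ℝ) (Φ₁ Ψ₂ : ℝ≥0∞ → ℝ≥0∞) : Prop :=
  ∃ C : ℝ, 0 < C ∧ ∀ t : ℝ, 0 < t →
    (∫⁻ s in Ioo 0 t, Φ₁ (betaFn q γ Ψ₂ t / ENNReal.ofReal (C * s ^ (1 / q))) *
        ENNReal.ofReal (s ^ γ)) ≤ betaFn q γ Ψ₂ t ∧
      betaFn q γ Ψ₂ t < ∞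

/-- Second integral condition: `β(t) < ∞` and
`∫₀ᵗ φ₁(β(t) / (C s^{1/q})) s^{γ - 1/q} ds ≤ C` for all `t > 0`, with one constant `C > 0`. -/
def BKCond' (q γ : ℝ) (φ₁ : ℝ → ℝ) (Ψ₂ : ℝ≥0∞ → ℝ≥0∞) : Prop :=
  ∃ C : ℝ, 0 < C ∧ ∀ t : ℝ, 0 < t →
    betaFn q γ Ψ₂ t < ∞ ∧
      (∫⁻ s in Ioo 0 t, ENNReal.ofReal (φ₁ ((betaFn q γ Ψ₂ t).toReal / (C * s ^ (1 / q)))) *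
        ENNReal.ofReal (s ^ (γ - 1 / q))) ≤ ENNReal.ofReal C

end

/-! Dilations drive the proof. `Q_q` commutes with `f ↦ f(c·)`, and dilating by `c` divides every
modular by `c^(γ+1)`. Since `γ + 1 ≠ 0`, a modular inequality need only be known on the unit ball
(`modularIneq_of_unit_ball`). This identifies the norm inequality, the modular inequality and
continuity. The two integral conditions agree because `Φ₁(x) ≤ x φ₁(x) ≤ Φ₁(2x)` and `β > 0`.

Necessity of the integral condition: with `x = s^(1/q-1-γ)`, the function `Ψ₂(x)/x` on `(t, ∞)` has
modular at most `β(t)` because `Φ₂(Ψ₂(x)/x) ≤ Ψ₂(x)`, while its tail integral from any `s < t` is at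
least `β(t)`.

Sufficiency: by dilation the condition holds with `Ψ₂` replaced by `Ψ₂(ε ·)` for every `ε > 0`.
Choosing `ε` to balance the two terms of Young's inequality gives the modular inequality on `(0, a)`
for functions carried by `(a, ∞)` (`setLIntegral_youngFn_div_le`). The general case
(`modular_hardyQ_le`) cuts `(0, ∞)` along dyadic levels of the tail `I(t) = ∫_t^∞ f(s) s^(1/q-1)
ds`: where `2·2^n < I ≤ 4·2^n`, the tail is at most four times the integral over the slice `2^n ≤ I
< 2·2^n`, which lies further right. The slices are disjoint, so the estimates add up. -/

/-! ### Young functions and dilation of integrals. -/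

theorem youngFn_mono (φ : ℝ → ℝ) : Monotone (youngFn φ) := fun _ _ h =>
  lintegral_mono_set fun _ hs => ⟨hs.1, hs.2.trans_le h⟩

theorem youngFn_ofReal (φ : ℝ → ℝ) (x : ℝ) :
    youngFn φ (ENNReal.ofReal x) = ∫⁻ s in Ioo 0 x, ENNReal.ofReal (φ s) := by
  have : {s : ℝ | 0 < s ∧ ENNReal.ofReal s < ENNReal.ofReal x} = Ioo 0 x := by
    ext s
    change _ ∧ _ ↔ _ ∧ _
    exact and_congr_right fun h => ENNReal.ofReal_lt_ofReal_iff_of_nonneg h.le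
  rw [youngFn, this]

theorem youngFn_zero (φ : ℝ → ℝ) : youngFn φ 0 = 0 := by
  simp [youngFn]

theorem youngFn_le_mul {φ : ℝ → ℝ} (hφ : MonotoneOn φ (Ioi 0)) {x : ℝ} (hx : 0 < x) :
    youngFn φ (ENNReal.ofReal x) ≤ ENNReal.ofReal x * ENNReal.ofReal (φ x) := by
  rw [youngFn_ofReal]
  calc ∫⁻ s in Ioo 0 x, ENNReal.ofReal (φ s) ≤ ∫⁻ _ in Ioo 0 x, ENNReal.ofReal (φ x) :=
        setLIntegral_mono' measurableSet_Ioo fun s hs =>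
          ENNReal.ofReal_le_ofReal (hφ hs.1 hx hs.2.le)
    _ = ENNReal.ofReal x * ENNReal.ofReal (φ x) := by
        rw [setLIntegral_const, Real.volume_Ioo, sub_zero, mul_comm]

theorem mul_le_youngFn {φ : ℝ → ℝ} (hφ : MonotoneOn φ (Ioi 0)) {x : ℝ} (hx : 0 < x) :
    ENNReal.ofReal x * ENNReal.ofReal (φ x) ≤ youngFn φ (ENNReal.ofReal (2 * x)) := by
  rw [youngFn_ofReal]
  calc ENNReal.ofReal x * ENNReal.ofReal (φ x) = ∫⁻ _ in Ioo x (2 * x), ENNReal.ofReal (φ x) := by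
        rw [setLIntegral_const, Real.volume_Ioo, mul_comm]; ring_nf
    _ ≤ ∫⁻ s in Ioo x (2 * x), ENNReal.ofReal (φ s) :=
        setLIntegral_mono' measurableSet_Ioo fun s hs =>
          ENNReal.ofReal_le_ofReal (hφ hx (hx.trans hs.1) hs.1.le)
    _ ≤ _ := lintegral_mono_set (Ioo_subset_Ioo_left hx.le)

/-- Dilation of the variable in a Lebesgue integral over a measurable set. -/
theorem setLIntegral_comp_mul_left {c : ℝ} (hc : 0 < c) (g : ℝ → ℝ≥0∞) (S : Set ℝ) :
    ∫⁻ s in S, g s = ENNReal.ofReal c * ∫⁻ s in (fun s => c * s) ⁻¹' S, g (c * s) := by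
  have he : MeasurableEmbedding (fun s : ℝ => c * s) := measurableEmbedding_mulLeft₀ hc.ne'
  have h1 : (volume : Measure ℝ) = ENNReal.ofReal c • Measure.map (fun s => c * s) volume := by
    rw [Real.map_volume_mul_left hc.ne', smul_smul, abs_of_pos (inv_pos.2 hc),
      ← ENNReal.ofReal_mul hc.le, mul_inv_cancel₀ hc.ne', ENNReal.ofReal_one, one_smul]
  conv_lhs => rw [h1]
  rw [Measure.restrict_smul, lintegral_smul_measure, he.restrict_map, he.lintegral_map, smul_eq_mul]

theorem setLIntegral_Ioi_comp_mul_left {c : ℝ} (hc : 0 < c) (g : ℝ → ℝ≥0∞) (a : ℝ) :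
    ∫⁻ s in Ioi (c * a), g s = ENNReal.ofReal c * ∫⁻ s in Ioi a, g (c * s) := by
  rw [setLIntegral_comp_mul_left hc g]
  congr 3
  ext s
  simp [hc, mul_div_cancel_left₀ a hc.ne']

theorem setLIntegral_Ioo_comp_mul_left {c : ℝ} (hc : 0 < c) (g : ℝ → ℝ≥0∞) (a : ℝ) :
    ∫⁻ s in Ioo 0 (c * a), g s = ENNReal.ofReal c * ∫⁻ s in Ioo 0 a, g (c * s) := by
  rw [setLIntegral_comp_mul_left hc g]
  congr 3
  ext s
  simp [hc, mul_div_cancel_left₀ a hc.ne']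

theorem youngFn_mul_le {φ : ℝ → ℝ} (hφ : MonotoneOn φ (Ioi 0)) {θ x : ℝ} (hθ : 0 < θ)
    (hθ1 : θ ≤ 1) :
    youngFn φ (ENNReal.ofReal (θ * x)) ≤ ENNReal.ofReal θ * youngFn φ (ENNReal.ofReal x) := by
  rw [youngFn_ofReal, youngFn_ofReal, setLIntegral_Ioo_comp_mul_left hθ]
  gcongr 1
  refine setLIntegral_mono' measurableSet_Ioo fun s hs => ENNReal.ofReal_le_ofReal ?_
  exact hφ (mul_pos hθ hs.1) hs.1 (mul_le_of_le_one_left hs.1.le hθ1)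

/-! ### The generalized inverse and the complementary function. -/

namespace IsYoungDensity

variable {φ : ℝ → ℝ}

theorem youngFn_top (h : IsYoungDensity φ) : youngFn φ ∞ = ∞ := by
  refine top_unique (le_of_tendsto ENNReal.tendsto_ofReal_atTop ?_)
  filter_upwards [h.tendsto_top.eventually_ge_atTop 1, eventually_gt_atTop 0] with x hx hx0
  calc ENNReal.ofReal x = ENNReal.ofReal x * ENNReal.ofReal 1 := by simp
    _ ≤ ENNReal.ofReal x * ENNReal.ofReal (φ x) := by gcongr
    _ ≤ _ := (mul_le_youngFn h.mono hx0).trans (youngFn_mono φ le_top)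

theorem genInv_set_nonempty (h : IsYoungDensity φ) (y : ℝ) : {t : ℝ | 0 < t ∧ y ≤ φ t}.Nonempty :=
  ((eventually_gt_atTop 0).and (h.tendsto_top.eventually_ge_atTop y)).exists

theorem bddBelow_genInv_set (φ : ℝ → ℝ) (y : ℝ) : BddBelow {t : ℝ | 0 < t ∧ y ≤ φ t} :=
  ⟨0, fun _ ht => ht.1.le⟩

theorem genInv_le {t y : ℝ} (ht : 0 < t) (h : y ≤ φ t) : genInv φ y ≤ t :=
  csInf_le (bddBelow_genInv_set φ y) ⟨ht, h⟩

theorem le_genInv (h : IsYoungDensity φ) {t y : ℝ} (ht : 0 < t) (hy : φ t < y) :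
    t ≤ genInv φ y :=
  le_csInf (h.genInv_set_nonempty y) fun s hs => by
    by_contra! hst
    exact (hs.2.trans (h.mono hs.1 ht hst.le)).not_gt hy

theorem genInv_monotone (h : IsYoungDensity φ) : Monotone (genInv φ) := fun _ b hab =>
  csInf_le_csInf (bddBelow_genInv_set φ _) (h.genInv_set_nonempty b)
    fun _ ht => ⟨ht.1, hab.trans ht.2⟩

theorem genInv_pos (h : IsYoungDensity φ) {y : ℝ} (hy : 0 < y) : 0 < genInv φ y := by
  obtain ⟨t, ht, ht0⟩ := ((h.tendsto_zero.eventually_lt_const hy).and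
    self_mem_nhdsWithin).exists
  exact lt_of_lt_of_le ht0 (h.le_genInv ht0 ht)

theorem complFn_lt_top (h : IsYoungDensity φ) (y : ℝ) : complFn φ (ENNReal.ofReal y) < ∞ := by
  rcases le_or_gt y 0 with hy | hy
  · simp [ENNReal.ofReal_of_nonpos hy, complFn, youngFn_zero]
  · exact (youngFn_le_mul (h.genInv_monotone.monotoneOn _) hy).trans_lt
      (ENNReal.mul_lt_top ENNReal.ofReal_lt_top ENNReal.ofReal_lt_top)

theorem complFn_pos (h : IsYoungDensity φ) {y : ℝ} (hy : 0 < y) :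
    0 < complFn φ (ENNReal.ofReal y) := by
  have := mul_le_youngFn (h.genInv_monotone.monotoneOn _) (half_pos hy)
  rw [mul_div_cancel₀ y two_ne_zero] at this
  exact (ENNReal.mul_pos (by simpa using hy) (by simpa using h.genInv_pos (half_pos hy))).trans_le
    this

/-- Young's inequality, up to constants. -/
theorem mul_le_two_mul_add (h : IsYoungDensity φ) (x : ℝ≥0) {y : ℝ} (hy : 0 < y) :
    (x : ℝ≥0∞) * ENNReal.ofReal y ≤
      2 * (youngFn φ x + complFn φ (ENNReal.ofReal (2 * y))) := by
  rcases eq_or_ne x 0 with rfl | hx0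
  · simp
  have hx : (0 : ℝ) < x / 2 := by positivity
  have e : (x : ℝ≥0∞) = ENNReal.ofReal (2 * (x / 2 : ℝ)) := by
    rw [mul_div_cancel₀ _ two_ne_zero, ENNReal.ofReal_coe_nnreal]
  have e2 : (x : ℝ≥0∞) = 2 * ENNReal.ofReal (x / 2 : ℝ) := by
    rw [e, ENNReal.ofReal_mul zero_le_two, ENNReal.ofReal_ofNat]
  nth_rewrite 1 [e2]
  rw [mul_assoc]
  gcongr 2 * ?_
  -- Either `(x/2) y ≤ (x/2) φ(x/2) ≤ Φ(x)`, or `x/2 ≤ φ⁻¹(y)` and `(x/2) y ≤ y φ⁻¹(y) ≤ Ψ(2y)`.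
  rcases le_or_gt y (φ (x / 2)) with hxy | hxy
  · refine le_trans ?_ le_self_add
    rw [e]
    exact le_trans (by gcongr) (mul_le_youngFn h.mono hx)
  · refine le_trans ?_ le_add_self
    rw [mul_comm]
    refine le_trans ?_ (mul_le_youngFn (h.genInv_monotone.monotoneOn _) hy)
    gcongr
    exact h.le_genInv hx hxy

/-- Put `z = Ψ(x)/x`. Then `z ≤ φ⁻¹(x)`, so `φ < x` on `(0, z)` and `Φ(z) ≤ z x = Ψ(x)`. -/
theorem youngFn_complFn_div_le (h : IsYoungDensity φ) {x : ℝ} (hx : 0 < x) :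
    youngFn φ (complFn φ (ENNReal.ofReal x) / ENNReal.ofReal x) ≤ complFn φ (ENNReal.ofReal x) := by
  set z : ℝ := (complFn φ (ENNReal.ofReal x)).toReal / x with hz
  have hx' : ENNReal.ofReal x ≠ 0 := by simpa using hx
  have e : complFn φ (ENNReal.ofReal x) / ENNReal.ofReal x = ENNReal.ofReal z := by
    rw [hz, ENNReal.ofReal_div_of_pos hx, ENNReal.ofReal_toReal (h.complFn_lt_top x).ne]
  have hzx : ENNReal.ofReal z * ENNReal.ofReal x = complFn φ (ENNReal.ofReal x) := by
    rw [← e, ENNReal.div_mul_cancel hx' ENNReal.ofReal_ne_top]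
  have hle : z ≤ genInv φ x := by
    rw [← ENNReal.ofReal_le_ofReal_iff (h.genInv_pos hx).le, ← e]
    refine ENNReal.div_le_of_le_mul' ?_
    exact youngFn_le_mul (h.genInv_monotone.monotoneOn _) hx
  rw [e, youngFn_ofReal]
  calc ∫⁻ s in Ioo 0 z, ENNReal.ofReal (φ s) ≤ ∫⁻ _ in Ioo 0 z, ENNReal.ofReal x := by
        refine setLIntegral_mono' measurableSet_Ioo fun s hs => ENNReal.ofReal_le_ofReal ?_
        by_contra! hsx
        exact ((genInv_le hs.1 hsx.le).trans_lt hs.2).not_ge hle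
    _ = complFn φ (ENNReal.ofReal x) := by
        rw [setLIntegral_const, Real.volume_Ioo, sub_zero, mul_comm, hzx]

end IsYoungDensity

/-! ### The Hardy operator, modulars and gauges under dilation. -/

/-- `∫_t^∞ f(s) s^{1/q - 1} ds`, the integral in the Hardy operator `Q_q`. -/
noncomputable def hardyTail (q : ℝ) (f : ℝ → ℝ≥0) (t : ℝ) : ℝ≥0∞ :=
  ∫⁻ s in Ioi t, (f s : ℝ≥0∞) * ENNReal.ofReal (s ^ (1 / q - 1))

theorem hardyQ_eq (q : ℝ) (f : ℝ → ℝ≥0) (t : ℝ) :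
    hardyQ q f t = ENNReal.ofReal (t ^ (-(1 / q))) * hardyTail q f t := rfl

theorem hardyTail_antitone (q : ℝ) (f : ℝ → ℝ≥0) : Antitone (hardyTail q f) := fun _ _ h =>
  lintegral_mono_set (Ioi_subset_Ioi h)

theorem hardyTail_const_mul (q : ℝ) (c : ℝ≥0) (f : ℝ → ℝ≥0) (t : ℝ) :
    hardyTail q (fun s => c * f s) t = c * hardyTail q f t := by
  simp only [hardyTail, ENNReal.coe_mul, mul_assoc]
  rw [lintegral_const_mul' _ _ ENNReal.coe_ne_top]

theorem hardyQ_const_mul (q : ℝ) (c : ℝ≥0) (f : ℝ → ℝ≥0) (t : ℝ) :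
    hardyQ q (fun s => c * f s) t = c * hardyQ q f t := by
  rw [hardyQ_eq, hardyTail_const_mul, hardyQ_eq, mul_left_comm]

theorem ofReal_rpow_mul {a b : ℝ} (ha : 0 < a) (hb : 0 < b) (r : ℝ) :
    ENNReal.ofReal ((a * b) ^ r) = ENNReal.ofReal (a ^ r) * ENNReal.ofReal (b ^ r) := by
  rw [Real.mul_rpow ha.le hb.le, ENNReal.ofReal_mul (by positivity)]

theorem ofReal_mul_ofReal_rpow {a : ℝ} (ha : 0 < a) (r s : ℝ) :
    ENNReal.ofReal (a ^ r) * ENNReal.ofReal (a ^ s) = ENNReal.ofReal (a ^ (r + s)) := by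
  rw [← ENNReal.ofReal_mul (by positivity), ← Real.rpow_add ha]

/-- The operator `Q_q` commutes with dilations. -/
theorem hardyQ_comp_mul_left (q : ℝ) (f : ℝ → ℝ≥0) {c t : ℝ} (hc : 0 < c) (ht : 0 < t) :
    hardyQ q (fun s => f (c * s)) t = hardyQ q f (c * t) := by
  simp only [hardyQ]
  rw [setLIntegral_Ioi_comp_mul_left hc, ofReal_rpow_mul hc ht]
  have : ∫⁻ s in Ioi t, (f (c * s) : ℝ≥0∞) * ENNReal.ofReal ((c * s) ^ (1 / q - 1)) =
      ENNReal.ofReal (c ^ (1 / q - 1)) *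
        ∫⁻ s in Ioi t, (f (c * s) : ℝ≥0∞) * ENNReal.ofReal (s ^ (1 / q - 1)) := by
    rw [← lintegral_const_mul' _ _ ENNReal.ofReal_ne_top]
    refine setLIntegral_congr_fun measurableSet_Ioi fun s hs => ?_
    simp only [ofReal_rpow_mul hc (ht.trans (mem_Ioi.1 hs))]
    ring
  rw [this]
  have h1 : ENNReal.ofReal (c ^ (-(1 / q))) * (ENNReal.ofReal c *
      ENNReal.ofReal (c ^ (1 / q - 1))) = 1 := by
    nth_rewrite 2 [← Real.rpow_one c]
    rw [ofReal_mul_ofReal_rpow hc, ofReal_mul_ofReal_rpow hc]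
    simp
  calc _ = 1 * (ENNReal.ofReal (t ^ (-(1 / q))) *
        ∫⁻ s in Ioi t, (f (c * s) : ℝ≥0∞) * ENNReal.ofReal (s ^ (1 / q - 1))) := by rw [one_mul]
    _ = _ := by rw [← h1]; ring

theorem modular_comp_mul_left (Φ : ℝ≥0∞ → ℝ≥0∞) (γ : ℝ) (h : ℝ → ℝ≥0∞) {c : ℝ} (hc : 0 < c) :
    modular Φ γ h = ENNReal.ofReal (c ^ (γ + 1)) * modular Φ γ (fun t => h (c * t)) := by
  have := setLIntegral_Ioi_comp_mul_left hc (fun t => Φ (h t) * ENNReal.ofReal (t ^ γ)) 0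
  rw [mul_zero] at this
  rw [modular, this, modular, add_comm, ← ofReal_mul_ofReal_rpow hc, mul_assoc, Real.rpow_one,
    ← lintegral_const_mul' (ENNReal.ofReal (c ^ γ)) _ ENNReal.ofReal_ne_top]
  congr 1
  refine setLIntegral_congr_fun measurableSet_Ioi fun s hs => ?_
  simp only [ofReal_rpow_mul hc hs]
  ring

theorem modular_mono {Φ : ℝ≥0∞ → ℝ≥0∞} (hΦ : Monotone Φ) (γ : ℝ) {h k : ℝ → ℝ≥0∞}
    (hk : ∀ t, 0 < t → h t ≤ k t) : modular Φ γ h ≤ modular Φ γ k :=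
  setLIntegral_mono' measurableSet_Ioi fun t ht => mul_le_mul_left (hΦ (hk t ht)) _

theorem gauge₁_mono {Φ : ℝ≥0∞ → ℝ≥0∞} (hΦ : Monotone Φ) (γ : ℝ) {h k : ℝ → ℝ≥0∞}
    (hk : ∀ t, 0 < t → h t ≤ k t) : gauge₁ Φ γ h ≤ gauge₁ Φ γ k := by
  refine le_iInf fun l => le_iInf fun hl => le_iInf fun hm => ?_
  exact iInf_le_of_le l <| iInf_le_of_le hl <| iInf_le_of_le
    ((modular_mono hΦ γ fun t ht => ENNReal.div_le_div_right (hk t ht) _).trans hm) le_rfl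

theorem gauge₁_le {Φ : ℝ≥0∞ → ℝ≥0∞} {γ : ℝ} {h : ℝ → ℝ≥0∞} {l : ℝ} (hl : 0 < l)
    (hm : modular Φ γ (fun t => h t / ENNReal.ofReal l) ≤ 1) : gauge₁ Φ γ h ≤ ENNReal.ofReal l :=
  iInf_le_of_le l <| iInf_le_of_le hl <| iInf_le_of_le hm le_rfl

theorem modular_div_le_one_of_gauge₁_lt {Φ : ℝ≥0∞ → ℝ≥0∞} (hΦ : Monotone Φ) {γ : ℝ}
    {h : ℝ → ℝ≥0∞} {x : ℝ≥0∞} (hx : gauge₁ Φ γ h < x) :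
    modular Φ γ (fun t => h t / x) ≤ 1 := by
  simp only [gauge₁, iInf_lt_iff] at hx
  obtain ⟨l, hl, hm, hlx⟩ := hx
  exact (modular_mono hΦ γ fun t _ => by gcongr).trans hm

theorem aemeasurable_comp_mul_left {β : Type*} [MeasurableSpace β] {f : ℝ → β} {c : ℝ} (hc : 0 < c)
    (hf : AEMeasurable f (volume.restrict (Ioi 0))) :
    AEMeasurable (fun s => f (c * s)) (volume.restrict (Ioi 0)) := by
  have he : MeasurableEmbedding (fun s : ℝ => c * s) := measurableEmbedding_mulLeft₀ hc.ne'
  have hpre : (fun s : ℝ => c * s) ⁻¹' Ioi 0 = Ioi 0 := by ext s; simp [hc]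
  have h1 := hf.smul_measure (ENNReal.ofReal |c⁻¹|)
  rw [← Measure.restrict_smul, ← Real.map_volume_mul_left hc.ne', he.restrict_map, hpre,
    he.aemeasurable_map_iff] at h1
  exact h1

/-- A bound on the unit ball for the modulars, dilated, gives the modular inequality. -/
theorem modularIneq_of_unit_ball {q γ : ℝ} (hγ : γ ≠ -1) {Φ₁ Φ₂ : ℝ≥0∞ → ℝ≥0∞}
    (hΦ₁ : Monotone Φ₁) {K : ℝ} (hK : 0 < K)
    (h : ∀ f : ℝ → ℝ≥0, AEMeasurable f (volume.restrict (Ioi 0)) →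
      modular Φ₂ γ (fun s => ENNReal.ofReal K * (f s : ℝ≥0∞)) ≤ 1 →
        modular Φ₁ γ (hardyQ q f) ≤ 1) : ModularIneq q γ Φ₁ Φ₂ := by
  refine ⟨K, hK, fun f hf => le_of_forall_gt_imp_ge_of_dense fun y hy => ?_⟩
  rcases eq_or_ne y ∞ with rfl | hytop
  · exact le_top
  lift y to ℝ≥0 using hytop
  have hy0 : (0 : ℝ) < y := by exact_mod_cast pos_of_gt hy
  have hγ' : γ + 1 ≠ 0 := fun h0 => hγ (by linarith)
  -- Dilation by `c` divides both modulars by `y`. Taking `y` strictly above the right-hand side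
  -- keeps it positive even when that side vanishes.
  set c : ℝ := (y : ℝ) ^ (1 / (γ + 1)) with hc
  have hc0 : 0 < c := by positivity
  have hcy : ENNReal.ofReal (c ^ (γ + 1)) = y := by
    rw [hc, ← Real.rpow_mul hy0.le, one_div_mul_cancel hγ', Real.rpow_one, ENNReal.ofReal_coe_nnreal]
  have hy0' : (y : ℝ≥0∞) ≠ 0 := by exact_mod_cast hy0.ne'
  have h1 := h (fun s => f (c * s)) (aemeasurable_comp_mul_left hc0 hf) (by
    rw [modular_comp_mul_left _ _ _ hc0, hcy] at hy
    by_contra! hlt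
    exact hy.not_ge ((mul_one _).symm.trans_le (by gcongr)))
  rw [modular_comp_mul_left _ _ _ hc0, hcy]
  calc (y : ℝ≥0∞) * modular Φ₁ γ (fun t => hardyQ q f (c * t))
      ≤ y * modular Φ₁ γ (hardyQ q (fun s => f (c * s))) := by
        gcongr 1
        exact modular_mono hΦ₁ γ fun t ht => (hardyQ_comp_mul_left q f hc0 ht).ge
    _ ≤ y * 1 := by gcongr
    _ = y := mul_one _

/-! ### Norm inequality and modular inequality. -/

theorem GaugeIneq.modularIneq {q γ : ℝ} (hγ : γ ≠ -1) {Φ₁ Φ₂ : ℝ≥0∞ → ℝ≥0∞}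
    (hΦ₁ : Monotone Φ₁) (h : GaugeIneq q γ Φ₁ Φ₂) : ModularIneq q γ Φ₁ Φ₂ := by
  obtain ⟨L, hL, h⟩ := h
  -- The factor 2 brings the gauge of `Q_q f` down to `1/2`, strictly below 1, so the infimum need
  -- not be attained.
  refine modularIneq_of_unit_ball hγ hΦ₁ (K := 2 * L) (by positivity) fun f hf hm => ?_
  have h2 : gauge₁ Φ₂ γ (fun t => (f t : ℝ≥0∞)) ≤ ENNReal.ofReal (2 * L)⁻¹ := by
    refine gauge₁_le (by positivity) ?_
    rw [ENNReal.ofReal_inv_of_pos (by positivity)]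
    simpa only [div_eq_mul_inv, inv_inv, mul_comm] using hm
  have h3 : gauge₁ Φ₁ γ (hardyQ q f) < 1 := by
    refine (h f hf).trans_lt ((mul_le_mul_right h2 _).trans_lt ?_)
    rw [← ENNReal.ofReal_mul hL.le, ENNReal.ofReal_lt_one]
    field_simp
    norm_num
  simpa using modular_div_le_one_of_gauge₁_lt hΦ₁ h3

theorem ModularIneq.gaugeIneq {q γ : ℝ} {Φ₁ Φ₂ : ℝ≥0∞ → ℝ≥0∞}
    (h : ModularIneq q γ Φ₁ Φ₂) : GaugeIneq q γ Φ₁ Φ₂ := by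
  obtain ⟨K, hK, h⟩ := h
  have hK' : ENNReal.ofReal K ≠ 0 := by simpa using hK
  refine ⟨K, hK, fun f hf => ?_⟩
  rw [mul_comm, ← ENNReal.div_le_iff_le_mul (.inl hK') (.inl ENNReal.ofReal_ne_top)]
  refine le_iInf fun l => le_iInf fun hl => le_iInf fun hm => ?_
  have hl' : ENNReal.ofReal l ≠ 0 := by simpa using hl
  rw [ENNReal.div_le_iff_le_mul (.inl hK') (.inl ENNReal.ofReal_ne_top), ← ENNReal.ofReal_mul hl.le]
  refine gauge₁_le (by positivity) ?_
  -- Rescaling by `1/(lK)` leaves `f/l` on the right, of modular at most 1, and `Q_q f/(lK)` on the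
  -- left.
  have h1 := h (fun s => (l * K)⁻¹.toNNReal * f s) (hf.const_mul _)
  have e1 : hardyQ q (fun s => (l * K)⁻¹.toNNReal * f s) =
      fun t => hardyQ q f t / ENNReal.ofReal (l * K) := by
    funext t
    rw [hardyQ_const_mul, div_eq_mul_inv, mul_comm,
      ← ENNReal.ofReal_inv_of_pos (by positivity : 0 < l * K)]
    rfl
  have e2 : (fun s => ENNReal.ofReal K * (((l * K)⁻¹.toNNReal * f s : ℝ≥0) : ℝ≥0∞)) =
      fun s => (f s : ℝ≥0∞) / ENNReal.ofReal l := by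
    funext s
    rw [ENNReal.coe_mul, ← mul_assoc, div_eq_mul_inv, mul_comm (f s : ℝ≥0∞),
      ← ENNReal.ofReal_inv_of_pos hl, show (((l * K)⁻¹.toNNReal : ℝ≥0) : ℝ≥0∞) =
        ENNReal.ofReal (l * K)⁻¹ from rfl, ← ENNReal.ofReal_mul hK.le]
    congr 3
    field_simp
  rw [e1, e2] at h1
  exact h1.trans hm

/-! ### Continuity of the operator. -/

theorem enorm_ofReal_rpow {t : ℝ} (ht : 0 < t) (r : ℝ) : ‖t ^ r‖ₑ = ENNReal.ofReal (t ^ r) :=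
  Real.enorm_of_nonneg (by positivity)

theorem enorm_hardyQReal_le (q : ℝ) (f : ℝ → ℝ) {t : ℝ} (ht : 0 < t) :
    ‖hardyQReal q f t‖ₑ ≤ hardyQ q (fun s => ‖f s‖₊) t := by
  rw [hardyQReal, hardyQ, enorm_mul, enorm_ofReal_rpow ht]
  gcongr 1
  refine (enorm_integral_le_lintegral_enorm _).trans_eq ?_
  refine setLIntegral_congr_fun measurableSet_Ioi fun s hs => ?_
  rw [enorm_mul, enorm_ofReal_rpow (ht.trans (mem_Ioi.1 hs))]
  rfl

theorem hardyQ_eq_enorm_hardyQReal (q : ℝ) (f : ℝ → ℝ≥0)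
    (hf : HardyQDefined q fun s => (f s : ℝ)) {t : ℝ} (ht : 0 < t) :
    hardyQ q f t = ‖hardyQReal q (fun s => (f s : ℝ)) t‖ₑ := by
  have h0 : 0 ≤ᵐ[volume.restrict (Ioi t)] fun s => (f s : ℝ) * s ^ (1 / q - 1) := by
    filter_upwards [ae_restrict_mem measurableSet_Ioi] with s hs
    have := ht.trans (mem_Ioi.1 hs)
    positivity
  rw [hardyQReal, hardyQ, enorm_mul, enorm_ofReal_rpow ht,
    Real.enorm_of_nonneg (integral_nonneg_of_ae h0), ofReal_integral_eq_lintegral_ofReal (hf t ht) h0]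
  congr 1
  refine setLIntegral_congr_fun measurableSet_Ioi fun s hs => ?_
  simp only [ENNReal.ofReal_mul (NNReal.coe_nonneg (f s)), ENNReal.ofReal_coe_nnreal]

/-- Continuity at `0` with `ε = 1` is a bound on a small ball; the constant is the reciprocal of a
radius `d < δ`. -/
theorem ContinuousMapping.modularIneq {q γ : ℝ} (hγ : γ ≠ -1) {Φ₁ Φ₂ : ℝ≥0∞ → ℝ≥0∞}
    (hΦ₁ : Monotone Φ₁) (hΦ₂ : Φ₂ 0 = 0) (h : ContinuousMapping q γ Φ₁ Φ₂) :
    ModularIneq q γ Φ₁ Φ₂ := by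
  obtain ⟨hdef, hcont⟩ := h
  have hmem0 : MemOrlicz Φ₂ γ (fun _ => 0) := ⟨aemeasurable_const, 1, one_pos, by
    simp [modular, hΦ₂]⟩
  obtain ⟨δ, hδ, h⟩ := hcont _ hmem0 1 one_pos
  obtain ⟨d, hd, hdδ⟩ := ENNReal.lt_iff_exists_nnreal_btwn.1 hδ
  have hd0 : (0 : ℝ) < d := by exact_mod_cast hd
  refine modularIneq_of_unit_ball hγ hΦ₁ (inv_pos.2 hd0) fun f hf hm => ?_
  have hmem : MemOrlicz Φ₂ γ (fun s => (f s : ℝ)) :=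
    ⟨hf.coe_nnreal_real, (d : ℝ)⁻¹, inv_pos.2 hd0, by
      simpa using hm.trans_lt ENNReal.one_lt_top⟩
  have h1 := h _ hmem (by
    refine lt_of_le_of_lt ?_ hdδ
    rw [← ENNReal.ofReal_coe_nnreal]
    refine gauge₁_le hd0 ?_
    rw [ENNReal.ofReal_inv_of_pos hd0] at hm
    simpa [div_eq_mul_inv, mul_comm] using hm)
  have h2 := modular_div_le_one_of_gauge₁_lt hΦ₁ h1
  refine le_trans (modular_mono hΦ₁ γ fun t ht => ?_) h2
  rw [hardyQ_eq_enorm_hardyQReal q f (hdef _ hmem).1 ht]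
  simp [hardyQReal]

/-- An infinite tail at `t` is infinite on all of `(0, t)`, where `Φ(∞) = ∞` makes the modular
infinite. -/
theorem hardyTail_lt_top_of_modular_lt_top {q γ : ℝ} {Φ : ℝ≥0∞ → ℝ≥0∞} (hΦ : Φ ∞ = ∞)
    {f : ℝ → ℝ≥0} (hm : modular Φ γ (hardyQ q f) < ∞) {t : ℝ} (ht : 0 < t) :
    hardyTail q f t < ∞ := by
  by_contra! htop
  refine hm.not_ge ?_
  calc ∞ = ∫⁻ _ in Ioo 0 t, ∞ := by
        rw [setLIntegral_const, Real.volume_Ioo, ENNReal.top_mul]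
        simpa using ht
    _ ≤ ∫⁻ s in Ioo 0 t, Φ (hardyQ q f s) * ENNReal.ofReal (s ^ γ) := by
        refine setLIntegral_mono' measurableSet_Ioo fun s hs => ?_
        have hp : ∀ r : ℝ, ENNReal.ofReal (s ^ r) ≠ 0 := fun r => by
          simpa using Real.rpow_pos_of_pos hs.1 r
        rw [hardyQ_eq, top_unique (htop.trans (hardyTail_antitone q f hs.2.le)),
          ENNReal.mul_top (hp _), hΦ, ENNReal.top_mul (hp _)]
    _ ≤ _ := lintegral_mono_set Ioo_subset_Ioi_self

theorem aemeasurable_hardyQReal {q : ℝ} {f : ℝ → ℝ} (hf : HardyQDefined q f) :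
    AEMeasurable (hardyQReal q f) (volume.restrict (Ioi 0)) := by
  have hanti : ∀ g : ℝ → ℝ≥0∞, Measurable fun t => ∫⁻ s in Ioi t, g s := fun g =>
    Antitone.measurable fun _ _ h => lintegral_mono_set (Ioi_subset_Ioi h)
  -- The tails of the positive and negative parts are antitone in `t`, hence measurable.
  refine ⟨fun t => t ^ (-(1 / q)) *
    ((∫⁻ s in Ioi t, ENNReal.ofReal (f s * s ^ (1 / q - 1))).toReal -
      (∫⁻ s in Ioi t, ENNReal.ofReal (-(f s * s ^ (1 / q - 1)))).toReal), ?_, ?_⟩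
  · exact (measurable_id.pow_const _).mul ((hanti _).ennreal_toReal.sub (hanti _).ennreal_toReal)
  · filter_upwards [ae_restrict_mem measurableSet_Ioi] with t ht
    rw [hardyQReal, integral_eq_lintegral_pos_part_sub_lintegral_neg_part (hf t ht)]

theorem ModularIneq.continuousMapping {q γ : ℝ} {Φ₁ Φ₂ : ℝ≥0∞ → ℝ≥0∞}
    (hΦ₁ : Monotone Φ₁) (hΦ₁' : Φ₁ ∞ = ∞) (h : ModularIneq q γ Φ₁ Φ₂) :
    ContinuousMapping q γ Φ₁ Φ₂ := by
  obtain ⟨L, hL, hgauge⟩ := h.gaugeIneq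
  obtain ⟨K, hK, h⟩ := h
  have hdef : ∀ f : ℝ → ℝ, MemOrlicz Φ₂ γ f → HardyQDefined q f ∧
      MemOrlicz Φ₁ γ (hardyQReal q f) := by
    rintro f ⟨hf, k, hk, hm⟩
    have hkK : 0 < k / K := by positivity
    have h1 := h (fun s => (k / K).toNNReal * ‖f s‖₊) (hf.nnnorm.const_mul _)
    have e : (fun s => ENNReal.ofReal K * (((k / K).toNNReal * ‖f s‖₊ : ℝ≥0) : ℝ≥0∞)) =
        fun s => ENNReal.ofReal k * ‖f s‖ₑ := by
      funext s
      rw [ENNReal.coe_mul, ← mul_assoc, show (((k / K).toNNReal : ℝ≥0) : ℝ≥0∞) =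
        ENNReal.ofReal (k / K) from rfl, ← ENNReal.ofReal_mul hK.le, mul_div_cancel₀ _ hK.ne']
      rfl
    rw [e] at h1
    have h2 := h1.trans_lt hm
    have hd : HardyQDefined q f := by
      intro t ht
      refine ⟨((hf.mono_measure (Measure.restrict_mono (Ioi_subset_Ioi ht.le) le_rfl)).mul
        (measurable_id.pow_const _).aemeasurable).aestronglyMeasurable, ?_⟩
      have h3 := hardyTail_lt_top_of_modular_lt_top hΦ₁' h2 ht
      rw [hardyTail_const_mul, ENNReal.mul_lt_top_iff] at h3
      have h4 : hardyTail q (fun s => ‖f s‖₊) t < ∞ := by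
        have : (((k / K).toNNReal : ℝ≥0) : ℝ≥0∞) ≠ 0 := by simpa using hkK
        rcases h3 with h3 | h3 | h3
        · exact h3.2
        · exact absurd h3 this
        · simp [h3]
      refine lt_of_eq_of_lt ?_ h4
      refine setLIntegral_congr_fun measurableSet_Ioi fun s hs => ?_
      rw [enorm_mul, enorm_ofReal_rpow (ht.trans (mem_Ioi.1 hs))]
      rfl
    refine ⟨hd, aemeasurable_hardyQReal hd, k / K, hkK, lt_of_le_of_lt ?_ h2⟩
    refine modular_mono hΦ₁ γ fun t ht => ?_
    rw [hardyQ_const_mul]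
    exact mul_le_mul_right (enorm_hardyQReal_le q f ht) _
  refine ⟨hdef, fun f hf ε hε => ⟨ε / ENNReal.ofReal L, ?_, fun g hg hδ => ?_⟩⟩
  · exact ENNReal.div_pos hε.ne' ENNReal.ofReal_ne_top
  have hL' : ENNReal.ofReal L ≠ 0 := by simpa using hL
  refine lt_of_le_of_lt ?_ ((ENNReal.lt_div_iff_mul_lt (.inl hL') (.inl ENNReal.ofReal_ne_top)).1 hδ)
  rw [mul_comm]
  refine le_trans (gauge₁_mono hΦ₁ γ fun t ht => ?_)
    (hgauge (fun s => ‖g s - f s‖₊) (hg.1.sub hf.1).nnnorm)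
  refine le_trans (le_of_eq ?_) (enorm_hardyQReal_le q (fun s => g s - f s) ht)
  simp only [hardyQReal, sub_mul]
  rw [integral_sub ((hdef g hg).1 t ht) ((hdef f hf).1 t ht), mul_sub]

/-! ### Equivalence of the two integral conditions. -/

theorem measurable_ofReal_rpow (r : ℝ) : Measurable fun s : ℝ => ENNReal.ofReal (s ^ r) :=
  (measurable_id.pow_const r).ennreal_ofReal

theorem measurable_betaFn_integrand {Ψ : ℝ≥0∞ → ℝ≥0∞} (hΨ : Monotone Ψ) (c r γ : ℝ) :
    Measurable fun s : ℝ => Ψ (ENNReal.ofReal (c * s ^ r)) * ENNReal.ofReal (s ^ γ) :=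
  (hΨ.measurable.comp ((measurable_id.pow_const r).const_mul c).ennreal_ofReal).mul
    (measurable_ofReal_rpow γ)

theorem ofReal_rpow_pos {s : ℝ} (hs : 0 < s) (r : ℝ) : 0 < ENNReal.ofReal (s ^ r) := by
  simpa using Real.rpow_pos_of_pos hs r

theorem setLIntegral_pos_of_forall_pos {S : Set ℝ} {g : ℝ → ℝ≥0∞} (hg : Measurable g)
    (hS : volume S ≠ 0) (h : ∀ s ∈ S, 0 < g s) : 0 < ∫⁻ s in S, g s := by
  have hsub : S ⊆ Function.support g := fun s hs => (h s hs).ne'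
  rw [setLIntegral_pos_iff hg, inter_eq_right.2 hsub]
  exact pos_iff_ne_zero.2 hS

theorem betaFn_pos {φ : ℝ → ℝ} (h : IsYoungDensity φ) (q γ : ℝ) {t : ℝ} (ht : 0 < t) :
    0 < betaFn q γ (complFn φ) t := by
  have hm := measurable_betaFn_integrand (youngFn_mono (genInv φ)) 1 (1 / q - 1 - γ) γ
  simp only [one_mul] at hm
  refine setLIntegral_pos_of_forall_pos hm (by simp) fun s hs => ?_
  have hs0 := ht.trans (mem_Ioi.1 hs)
  exact ENNReal.mul_pos (h.complFn_pos (Real.rpow_pos_of_pos hs0 _)).ne' (ofReal_rpow_pos hs0 γ).ne'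

theorem ofReal_div_mul_rpow {s C : ℝ} (hs : 0 < s) (hC : 0 < C) {b : ℝ} (hb : 0 ≤ b) (a γ : ℝ) :
    ENNReal.ofReal (b / (C * s ^ a)) * ENNReal.ofReal (s ^ γ) =
      ENNReal.ofReal (b / C) * ENNReal.ofReal (s ^ (γ - a)) := by
  rw [← ENNReal.ofReal_mul (by positivity), ← ENNReal.ofReal_mul (by positivity),
    Real.rpow_sub hs]
  congr 1
  field_simp

/-- This is `Φ(x) ≤ x φ(x)` at `x = b/(C s^a)`, where `x s^γ = (b/C) s^(γ-a)`. -/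
theorem setLIntegral_youngFn_le {φ : ℝ → ℝ} (hφ : MonotoneOn φ (Ioi 0)) {b C : ℝ} (hb : 0 < b)
    (hC : 0 < C) (a γ t : ℝ) :
    ∫⁻ s in Ioo 0 t, youngFn φ (ENNReal.ofReal b / ENNReal.ofReal (C * s ^ a)) *
        ENNReal.ofReal (s ^ γ) ≤ ENNReal.ofReal (b / C) *
      ∫⁻ s in Ioo 0 t, ENNReal.ofReal (φ (b / (C * s ^ a))) * ENNReal.ofReal (s ^ (γ - a)) := by
  rw [← lintegral_const_mul' _ _ ENNReal.ofReal_ne_top]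
  refine setLIntegral_mono' measurableSet_Ioo fun s hs => ?_
  have hsa : 0 < C * s ^ a := mul_pos hC (Real.rpow_pos_of_pos hs.1 a)
  rw [← ENNReal.ofReal_div_of_pos hsa]
  calc _ ≤ ENNReal.ofReal (b / (C * s ^ a)) * ENNReal.ofReal (φ (b / (C * s ^ a))) *
        ENNReal.ofReal (s ^ γ) := by
        gcongr
        exact youngFn_le_mul hφ (div_pos hb hsa)
    _ = ENNReal.ofReal (φ (b / (C * s ^ a))) *
        (ENNReal.ofReal (b / (C * s ^ a)) * ENNReal.ofReal (s ^ γ)) := by ring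
    _ = _ := by rw [ofReal_div_mul_rpow hs.1 hC hb.le]; ring

/-- This is `x φ(x) ≤ Φ(2x)` at `x = b/(2C s^a)`, divided by `b/(2C)`; the doubling costs a factor 2
in the constant. -/
theorem setLIntegral_density_le {φ : ℝ → ℝ} (hφ : MonotoneOn φ (Ioi 0)) {b C : ℝ} (hb : 0 < b)
    (hC : 0 < C) {a γ t : ℝ}
    (h : ∫⁻ s in Ioo 0 t, youngFn φ (ENNReal.ofReal b / ENNReal.ofReal (C * s ^ a)) *
        ENNReal.ofReal (s ^ γ) ≤ ENNReal.ofReal b) :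
    ∫⁻ s in Ioo 0 t, ENNReal.ofReal (φ (b / (2 * C * s ^ a))) * ENNReal.ofReal (s ^ (γ - a)) ≤
      ENNReal.ofReal (2 * C) := by
  have hb' : 0 < ENNReal.ofReal (b / (2 * C)) := by simpa using by positivity
  refine (ENNReal.mul_le_mul_iff_right hb'.ne' ENNReal.ofReal_ne_top).1 ?_
  rw [← ENNReal.ofReal_mul (by positivity), div_mul_cancel₀ _ (by positivity)]
  refine le_trans ?_ h
  rw [← lintegral_const_mul' _ _ ENNReal.ofReal_ne_top]
  refine setLIntegral_mono' measurableSet_Ioo fun s hs => ?_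
  have hsa : 0 < C * s ^ a := mul_pos hC (Real.rpow_pos_of_pos hs.1 a)
  rw [← ENNReal.ofReal_div_of_pos hsa]
  calc _ = ENNReal.ofReal (φ (b / (2 * C * s ^ a))) *
        (ENNReal.ofReal (b / (2 * C * s ^ a)) * ENNReal.ofReal (s ^ γ)) := by
        rw [ofReal_div_mul_rpow hs.1 (by positivity) hb.le]; ring
    _ = ENNReal.ofReal (b / (2 * C * s ^ a)) * ENNReal.ofReal (φ (b / (2 * C * s ^ a))) *
        ENNReal.ofReal (s ^ γ) := by ring
    _ ≤ _ := by
        gcongr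
        have := mul_le_youngFn hφ (x := b / (2 * C * s ^ a)) (by rw [mul_assoc]; positivity)
        rwa [show 2 * (b / (2 * C * s ^ a)) = b / (C * s ^ a) by field_simp] at this

theorem bkCond_of_bkCond' {q γ : ℝ} {φ₁ : ℝ → ℝ} (h₁ : IsYoungDensity φ₁) {Ψ : ℝ≥0∞ → ℝ≥0∞}
    (h : BKCond' q γ φ₁ Ψ) : BKCond q γ (youngFn φ₁) Ψ := by
  obtain ⟨C, hC, h⟩ := h
  refine ⟨C, hC, fun t ht => ⟨?_, (h t ht).1⟩⟩
  obtain ⟨hfin, hle⟩ := h t ht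
  lift betaFn q γ Ψ t to ℝ≥0 using hfin.ne with b
  rcases eq_or_ne b 0 with rfl | hb
  · simp [youngFn_zero]
  have hb0 : (0 : ℝ) < b := by positivity
  rw [← ENNReal.ofReal_coe_nnreal]
  refine (setLIntegral_youngFn_le h₁.mono hb0 hC _ _ _).trans ?_
  refine (mul_le_mul_right hle _).trans ?_
  rw [← ENNReal.ofReal_mul (by positivity), div_mul_cancel₀ _ hC.ne']

theorem bkCond'_of_bkCond {q γ : ℝ} {φ₁ φ₂ : ℝ → ℝ} (h₁ : IsYoungDensity φ₁)
    (h₂ : IsYoungDensity φ₂)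
    (h : BKCond q γ (youngFn φ₁) (complFn φ₂)) : BKCond' q γ φ₁ (complFn φ₂) := by
  obtain ⟨C, hC, h⟩ := h
  refine ⟨2 * C, by positivity, fun t ht => ⟨(h t ht).2, ?_⟩⟩
  obtain ⟨hle, hfin⟩ := h t ht
  refine setLIntegral_density_le h₁.mono (ENNReal.toReal_pos (betaFn_pos h₂ q γ ht).ne' hfin.ne)
    hC ?_
  rwa [ENNReal.ofReal_toReal hfin.ne]

/-! ### Necessity of the integral condition. -/

/-- The modular inequality tested on `Ψ₂(s^{1/q-1-γ}) / s^{1/q-1-γ}`. -/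
theorem modularIneq_test {q γ : ℝ} {φ₁ φ₂ : ℝ → ℝ} (h₂ : IsYoungDensity φ₂) {K : ℝ} (hK : 0 < K)
    (h : ∀ f : ℝ → ℝ≥0, AEMeasurable f (volume.restrict (Ioi 0)) →
      modular (youngFn φ₁) γ (hardyQ q f) ≤
        modular (youngFn φ₂) γ (fun s => ENNReal.ofReal K * (f s : ℝ≥0∞)))
    {t : ℝ} (ht : 0 < t) {S : Set ℝ} (hS : MeasurableSet S) (hSt : S ⊆ Ioi t) {b : ℝ≥0∞}
    (hb : b = ∫⁻ s in S, complFn φ₂ (ENNReal.ofReal (s ^ (1 / q - 1 - γ))) *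
      ENNReal.ofReal (s ^ γ)) :
    ∫⁻ s in Ioo 0 t, youngFn φ₁ (b / ENNReal.ofReal (K * s ^ (1 / q))) *
      ENNReal.ofReal (s ^ γ) ≤ b := by
  set x : ℝ → ℝ≥0∞ := fun s => ENNReal.ofReal (s ^ (1 / q - 1 - γ)) with hx
  set g : ℝ → ℝ≥0∞ := fun s => complFn φ₂ (x s) / x s with hg
  have hxm : Measurable x := measurable_ofReal_rpow _
  have hgm : Measurable g := ((youngFn_mono _).measurable.comp hxm).div hxm
  have hgtop : ∀ s, 0 < s → g s ≠ ∞ := fun s hs =>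
    (ENNReal.div_lt_top (h₂.complFn_lt_top _).ne (ofReal_rpow_pos hs _).ne').ne
  set f : ℝ → ℝ≥0 := S.indicator fun s => K⁻¹.toNNReal * (g s).toNNReal with hf
  have hfm : Measurable f := (hgm.ennreal_toNNReal.const_mul _).indicator hS
  have hfS : ∀ s ∈ S, (f s : ℝ≥0∞) = ENNReal.ofReal K⁻¹ * g s := fun s hs => by
    rw [hf, indicator_of_mem hs, ENNReal.coe_mul, ENNReal.coe_toNNReal (hgtop s (ht.trans (hSt hs)))]
    rfl
  have hK1 : ENNReal.ofReal K * ENNReal.ofReal K⁻¹ = 1 := by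
    rw [← ENNReal.ofReal_mul hK.le, mul_inv_cancel₀ hK.ne', ENNReal.ofReal_one]
  have hQ : ∀ s ∈ Ioo 0 t, b / ENNReal.ofReal (K * s ^ (1 / q)) ≤ hardyQ q f s := by
    intro s hs
    have hsK : 0 < K * s ^ (1 / q) := mul_pos hK (Real.rpow_pos_of_pos hs.1 _)
    -- Since `u^(1/q-1) = x(u) u^γ`, the factor `x` cancels the denominator of `g`. The tail from `s
    -- < t` contains all of `S`.
    have e : b = ENNReal.ofReal K *
        ∫⁻ u in S, (f u : ℝ≥0∞) * ENNReal.ofReal (u ^ (1 / q - 1)) := by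
      rw [← lintegral_const_mul' _ _ ENNReal.ofReal_ne_top, hb]
      refine setLIntegral_congr_fun hS fun u hu => ?_
      have hu0 : 0 < u := ht.trans (hSt hu)
      have e1 : ENNReal.ofReal (u ^ (1 / q - 1)) = x u * ENNReal.ofReal (u ^ γ) := by
        rw [hx, ofReal_mul_ofReal_rpow hu0]; ring_nf
      have e2 : g u * x u = complFn φ₂ (x u) :=
        ENNReal.div_mul_cancel (ofReal_rpow_pos hu0 _).ne' ENNReal.ofReal_ne_top
      simp only [hfS u hu, e1]
      calc complFn φ₂ (x u) * ENNReal.ofReal (u ^ γ)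
          = 1 * (g u * x u) * ENNReal.ofReal (u ^ γ) := by rw [e2, one_mul]
        _ = _ := by rw [← hK1]; ring
    have e3 : (ENNReal.ofReal (K * s ^ (1 / q)))⁻¹ =
        ENNReal.ofReal K⁻¹ * ENNReal.ofReal (s ^ (-(1 / q))) := by
      rw [← ENNReal.ofReal_inv_of_pos hsK, mul_inv, ENNReal.ofReal_mul (by positivity),
        Real.rpow_neg hs.1.le]
    rw [div_eq_mul_inv, e3, e]
    calc _ = (ENNReal.ofReal K * ENNReal.ofReal K⁻¹) * (ENNReal.ofReal (s ^ (-(1 / q))) *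
          ∫⁻ u in S, (f u : ℝ≥0∞) * ENNReal.ofReal (u ^ (1 / q - 1))) := by ring
      _ ≤ _ := by
        rw [hK1, one_mul, hardyQ]
        gcongr
        exact hSt.trans (Ioi_subset_Ioi hs.2.le)
  calc _ ≤ ∫⁻ s in Ioo 0 t, youngFn φ₁ (hardyQ q f s) * ENNReal.ofReal (s ^ γ) :=
        setLIntegral_mono' measurableSet_Ioo fun s hs =>
          mul_le_mul_left (youngFn_mono _ (hQ s hs)) _
    _ ≤ modular (youngFn φ₁) γ (hardyQ q f) := lintegral_mono_set Ioo_subset_Ioi_self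
    _ ≤ _ := h f hfm.aemeasurable
    _ ≤ ∫⁻ s, S.indicator (fun s => complFn φ₂ (x s) * ENNReal.ofReal (s ^ γ)) s := by
        refine le_trans (setLIntegral_mono' measurableSet_Ioi fun s hs => ?_)
          (setLIntegral_le_lintegral (Ioi 0) _)
        beta_reduce
        by_cases hsS : s ∈ S
        · rw [indicator_of_mem hsS, hfS s hsS, ← mul_assoc, hK1, one_mul]
          gcongr
          exact h₂.youngFn_complFn_div_le (Real.rpow_pos_of_pos hs _)
        · rw [indicator_of_notMem hsS, hf, indicator_of_notMem hsS]
          simp [youngFn_zero]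
    _ = b := by rw [lintegral_indicator hS, hb]

theorem ModularIneq.bkCond {q γ : ℝ} {φ₁ φ₂ : ℝ → ℝ} (h₁ : IsYoungDensity φ₁)
    (h₂ : IsYoungDensity φ₂) (h : ModularIneq q γ (youngFn φ₁) (youngFn φ₂)) :
    BKCond q γ (youngFn φ₁) (complFn φ₂) := by
  obtain ⟨K, hK, h⟩ := h
  refine ⟨K, hK, fun t ht => ⟨modularIneq_test h₂ hK h ht measurableSet_Ioi subset_rfl rfl, ?_⟩⟩
  -- If `β(t) = ∞`, subsets `S` of `(t, ∞)` give finite but arbitrarily large `b`. The density form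
  -- of the test keeps the bound `2K` while `φ₁ → ∞` on `(t/2, t)`.
  by_contra! htop
  set G : ℝ → ℝ≥0∞ := fun s => complFn φ₂ (ENNReal.ofReal (s ^ (1 / q - 1 - γ))) *
      ENNReal.ofReal (s ^ γ) with hG
  have : SigmaFinite (volume.withDensity G) :=
    SigmaFinite.withDensity_of_ne_top (ae_of_all _ fun s =>
      (ENNReal.mul_lt_top (h₂.complFn_lt_top _) ENNReal.ofReal_lt_top).ne)
  obtain ⟨M, hM⟩ : ∃ M, ∀ s ∈ Icc (t / 2) t, ‖s ^ (1 / q)‖ ≤ M :=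
    isCompact_Icc.exists_bound_of_continuousOn fun s hs =>
      (Real.continuousAt_rpow_const _ _ (.inl (by linarith [hs.1] : (0:ℝ) < s).ne')).continuousWithinAt
  have hMpos : 0 < M := (Real.rpow_pos_of_pos ht _).trans_le
    ((le_abs_self _).trans (hM t ⟨by linarith, le_rfl⟩))
  set w := ∫⁻ s in Ioo (t / 2) t, ENNReal.ofReal (s ^ (γ - 1 / q)) with hw
  have hwpos : 0 < w := setLIntegral_pos_of_forall_pos (measurable_ofReal_rpow _)
    (by simpa using ht) fun s hs => ofReal_rpow_pos (by linarith [hs.1]) _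
  have hNtop : ENNReal.ofReal (2 * K) / w ≠ ∞ :=
    (ENNReal.div_lt_top ENNReal.ofReal_ne_top hwpos.ne').ne
  obtain ⟨y, hy, hy0⟩ := ((h₁.tendsto_top.eventually_gt_atTop
    (ENNReal.ofReal (2 * K) / w).toReal).and (eventually_gt_atTop 0)).exists
  -- The threshold makes `b/(2K s^(1/q)) > y` on `(t/2, t)`, where `s^(1/q) ≤ M`, and `φ₁(y) >
  -- 2K/w`.
  obtain ⟨S, hS, hSt, hr, hfin⟩ := Measure.exists_subset_measure_lt_top
    (μ := volume.withDensity G) (r := ENNReal.ofReal (y * (2 * K * M))) measurableSet_Ioi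
    (by rw [withDensity_apply _ measurableSet_Ioi]; exact ENNReal.ofReal_lt_top.trans_le htop)
  rw [withDensity_apply _ hS] at hr hfin
  have htest := modularIneq_test h₂ hK h ht hS hSt rfl
  change _ < ∫⁻ s in S, G s at hr
  change ∫⁻ s in Ioo 0 t, youngFn φ₁ ((∫⁻ s in S, G s) / _) * _ ≤ ∫⁻ s in S, G s at htest
  set b := (∫⁻ s in S, G s).toReal with hb
  rw [← ENNReal.ofReal_toReal hfin.ne, ← hb] at htest hr
  have hyb : y * (2 * K * M) < b := (ENNReal.ofReal_lt_ofReal_iff_of_nonneg (by positivity)).1 hr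
  have hb0 : 0 < b := lt_trans (by positivity) hyb
  have hd := setLIntegral_density_le h₁.mono hb0 hK htest
  have hlow : ENNReal.ofReal (φ₁ y) * w ≤ ENNReal.ofReal (2 * K) := by
    refine le_trans ?_ hd
    rw [← lintegral_const_mul' _ _ ENNReal.ofReal_ne_top]
    refine le_trans (setLIntegral_mono' measurableSet_Ioo fun s hs => ?_)
      (lintegral_mono_set (Ioo_subset_Ioo_left (half_pos ht).le))
    gcongr
    have hs0 : 0 < s := by linarith [hs.1]
    have hsa : 0 < s ^ (1 / q) := Real.rpow_pos_of_pos hs0 _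
    have hsM : s ^ (1 / q) ≤ M := (le_abs_self _).trans (hM s ⟨hs.1.le, hs.2.le⟩)
    refine h₁.mono hy0 (mem_Ioi.2 (by positivity)) ?_
    rw [le_div_iff₀ (by positivity)]
    refine le_trans ?_ hyb.le
    gcongr
  have := ENNReal.le_div_iff_mul_le (.inl hwpos.ne') (.inr ENNReal.ofReal_ne_top) |>.2 hlow
  rw [ENNReal.ofReal_le_iff_le_toReal hNtop] at this
  exact hy.not_ge this

/-! ### Continuity and level sets of tail integrals. -/

theorem setLIntegral_Ioi_eq_lintegral_indicator (g : ℝ → ℝ≥0∞) (t : ℝ) :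
    ∫⁻ s in Ioi t, g s = ∫⁻ s, (Ioi t).indicator 1 s ∂(volume.withDensity g) := by
  rw [lintegral_indicator_one measurableSet_Ioi, withDensity_apply _ measurableSet_Ioi]

/-- With `g` moved into the measure, dominated convergence only asks for measurability of
indicators, so `g` may be arbitrary. -/
theorem tendsto_setLIntegral_Ioi {g : ℝ → ℝ≥0∞} {b : ℝ} (hg : ∫⁻ s in Ioi b, g s < ∞)
    {l : Filter ℝ} [l.IsCountablyGenerated] {F : ℝ → ℝ≥0∞} (hl : ∀ᶠ t in l, b < t)
    (hF : ∀ᵐ s ∂(volume.withDensity g), Tendsto (fun t => (Ioi t).indicator 1 s) l (𝓝 (F s))) :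
    Tendsto (fun t => ∫⁻ s in Ioi t, g s) l (𝓝 (∫⁻ s, F s ∂(volume.withDensity g))) := by
  simp only [setLIntegral_Ioi_eq_lintegral_indicator] at hg ⊢
  refine tendsto_lintegral_filter_of_dominated_convergence _
    (Eventually.of_forall fun t => measurable_one.indicator measurableSet_Ioi) ?_ hg.ne hF
  filter_upwards [hl] with t ht
  exact ae_of_all _ fun s => indicator_le_indicator_of_subset (Ioi_subset_Ioi ht.le) (by simp) s

theorem continuousOn_setLIntegral_Ioi {g : ℝ → ℝ≥0∞}
    (hg : ∀ t, 0 < t → ∫⁻ s in Ioi t, g s < ∞) :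
    ContinuousOn (fun t => ∫⁻ s in Ioi t, g s) (Ioi 0) := by
  intro t ht
  refine ContinuousAt.continuousWithinAt ?_
  have h := tendsto_setLIntegral_Ioi (hg (t / 2) (half_pos ht)) (l := 𝓝 t)
    (F := (Ioi t).indicator 1) (lt_mem_nhds (half_lt_self ht)) ?_
  · rwa [← setLIntegral_Ioi_eq_lintegral_indicator] at h
  have hne : ∀ᵐ s ∂(volume.withDensity g), s ≠ t :=
    (withDensity_absolutelyContinuous _ _).ae_le (Measure.ae_ne volume t)
  filter_upwards [hne] with s hs
  refine tendsto_const_nhds.congr' ?_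
  rcases lt_or_gt_of_ne hs with h | h
  · filter_upwards [lt_mem_nhds h] with u hu
    rw [indicator_of_notMem (by simpa using h.le), indicator_of_notMem (by simpa using hu.le)]
  · filter_upwards [gt_mem_nhds h] with u hu
    rw [indicator_of_mem (by simpa using h), indicator_of_mem (by simpa using hu)]

theorem tendsto_setLIntegral_Ioi_atTop {g : ℝ → ℝ≥0∞} {b : ℝ} (hg : ∫⁻ s in Ioi b, g s < ∞) :
    Tendsto (fun t => ∫⁻ s in Ioi t, g s) atTop (𝓝 0) := by
  have h := tendsto_setLIntegral_Ioi hg (l := atTop) (F := 0) (eventually_gt_atTop b)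
    (ae_of_all _ fun s => tendsto_const_nhds.congr' ?_)
  · simpa using h
  filter_upwards [eventually_ge_atTop s] with u hu
  rw [indicator_of_notMem (by simpa using hu)]
  rfl

/-- The point `a` is the greatest one with `I ≥ v`; the intermediate value theorem makes the value
there exactly `v`. -/
theorem exists_level_of_antitone {I : ℝ → ℝ≥0∞} (hI : Antitone I) (hc : ContinuousOn I (Ioi 0))
    (h0 : Tendsto I atTop (𝓝 0)) {v : ℝ≥0∞} (hv : 0 < v) {t : ℝ} (ht : 0 < t) (hvt : v < I t) :
    ∃ a, t < a ∧ I a = v ∧ ∀ s, v ≤ I s ↔ s ≤ a := by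
  obtain ⟨T, hT, htT⟩ := ((h0.eventually_lt_const hv).and (eventually_ge_atTop t)).exists
  have hcT : ContinuousOn I (Icc t T) := hc.mono fun s hs => ht.trans_le hs.1
  have hcomp : IsCompact (Icc t T ∩ I ⁻¹' Ici v) :=
    isCompact_Icc.of_isClosed_subset (hcT.preimage_isClosed_of_isClosed isClosed_Icc isClosed_Ici)
      inter_subset_left
  obtain ⟨a, ⟨haT, hva⟩, ha⟩ := hcomp.exists_isGreatest ⟨t, ⟨le_rfl, htT⟩, hvt.le⟩
  obtain ⟨s, hs, hsv⟩ := intermediate_value_Icc' htT hcT ⟨hT.le, hvt.le⟩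
  have hav : I a = v := le_antisymm (hsv ▸ hI (ha ⟨hs, hsv.ge⟩)) hva
  refine ⟨a, lt_of_not_ge fun h => (hI h).not_gt (hav ▸ hvt), hav, fun s => ⟨fun h => ?_,
    fun h => hva.trans (hI h)⟩⟩
  rcases le_or_gt s t with hst | hst
  · exact hst.trans haT.1
  · exact ha ⟨⟨hst.le, le_of_not_gt fun hTs => ((hI hTs.le).trans_lt hT).not_ge h⟩, h⟩

/-! ### The integral condition at every scale, and Young's inequality. -/

/-- `∫_a^∞ Ψ(ε s^{1/q-1-γ}) s^γ ds`. -/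
noncomputable def scaledBeta (q γ : ℝ) (Ψ : ℝ≥0∞ → ℝ≥0∞) (ε a : ℝ) : ℝ≥0∞ :=
  ∫⁻ s in Ioi a, Ψ (ENNReal.ofReal (ε * s ^ (1 / q - 1 - γ))) * ENNReal.ofReal (s ^ γ)

/-- Substituting `s ↦ s/μ` turns a dilation of the variable into a factor inside `Ψ`. When `1 + γ -
1/q ≠ 0`, every `ε > 0` is of the form `μ^(1+γ-1/q)`. -/
theorem scaledBeta_rpow_eq (q γ : ℝ) (Ψ : ℝ≥0∞ → ℝ≥0∞) {μ a : ℝ} (hμ : 0 < μ) (ha : 0 < a) :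
    scaledBeta q γ Ψ (μ ^ (1 + γ - 1 / q)) a =
      ENNReal.ofReal (μ ^ (γ + 1)) * betaFn q γ Ψ (μ⁻¹ * a) := by
  rw [betaFn, setLIntegral_Ioi_comp_mul_left (inv_pos.2 hμ), scaledBeta, ← mul_assoc,
    ← lintegral_const_mul' _ _ (ENNReal.mul_ne_top ENNReal.ofReal_ne_top ENNReal.ofReal_ne_top)]
  refine setLIntegral_congr_fun measurableSet_Ioi fun s hs => ?_
  have hs0 : 0 < s := ha.trans hs
  have e1 : (μ⁻¹ * s) ^ (1 / q - 1 - γ) = μ ^ (1 + γ - 1 / q) * s ^ (1 / q - 1 - γ) := by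
    rw [Real.mul_rpow (by positivity) hs0.le, Real.inv_rpow hμ.le, ← Real.rpow_neg hμ.le]
    ring_nf
  have e2 : ENNReal.ofReal (μ ^ (γ + 1)) * ENNReal.ofReal μ⁻¹ *
      ENNReal.ofReal ((μ⁻¹ * s) ^ γ) = ENNReal.ofReal (s ^ γ) := by
    rw [ofReal_rpow_mul (inv_pos.2 hμ) hs0, Real.inv_rpow hμ.le, ← Real.rpow_neg hμ.le,
      ← Real.rpow_neg_one, ← mul_assoc, ofReal_mul_ofReal_rpow hμ, ofReal_mul_ofReal_rpow hμ]
    simp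
  simp only [e1]
  rw [← e2]
  ring

theorem exists_rpow_eq {r : ℝ} (hr : r ≠ 0) {ε : ℝ} (hε : 0 < ε) : ∃ μ : ℝ, 0 < μ ∧ μ ^ r = ε :=
  ⟨ε ^ (1 / r), by positivity, by rw [← Real.rpow_mul hε.le, one_div_mul_cancel hr, Real.rpow_one]⟩

section Scaled

variable {q γ : ℝ} {φ₂ : ℝ → ℝ}

theorem scaledBeta_lt_top (hκ : 1 + γ - 1 / q ≠ 0)
    (hfin : ∀ t, 0 < t → betaFn q γ (complFn φ₂) t < ∞) {ε a : ℝ} (hε : 0 < ε) (ha : 0 < a) :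
    scaledBeta q γ (complFn φ₂) ε a < ∞ := by
  obtain ⟨μ, hμ, rfl⟩ := exists_rpow_eq hκ hε
  rw [scaledBeta_rpow_eq _ _ _ hμ ha]
  exact ENNReal.mul_lt_top ENNReal.ofReal_lt_top (hfin _ (by positivity))

/-- The hypothesis at `t = a/μ`, dilated by `μ`, where `ε = μ^(1+γ-1/q)`. -/
theorem setLIntegral_youngFn_scaledBeta_le {Φ : ℝ≥0∞ → ℝ≥0∞} (hκ : 1 + γ - 1 / q ≠ 0) {C : ℝ}
    (hC : 0 < C)
    (h : ∀ t, 0 < t → ∫⁻ s in Ioo 0 t, Φ (betaFn q γ (complFn φ₂) t /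
      ENNReal.ofReal (C * s ^ (1 / q))) * ENNReal.ofReal (s ^ γ) ≤ betaFn q γ (complFn φ₂) t)
    {ε a : ℝ} (hε : 0 < ε) (ha : 0 < a) :
    ∫⁻ s in Ioo 0 a, Φ (scaledBeta q γ (complFn φ₂) ε a /
      ENNReal.ofReal (C * ε * s ^ (1 / q))) * ENNReal.ofReal (s ^ γ) ≤
        scaledBeta q γ (complFn φ₂) ε a := by
  obtain ⟨μ, hμ, rfl⟩ := exists_rpow_eq hκ hε
  rw [scaledBeta_rpow_eq _ _ _ hμ ha]
  set b := betaFn q γ (complFn φ₂) (μ⁻¹ * a)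
  have ha' : Ioo 0 a = Ioo 0 (μ * (μ⁻¹ * a)) := by rw [mul_inv_cancel_left₀ hμ.ne']
  rw [ha', setLIntegral_Ioo_comp_mul_left hμ]
  refine le_trans (le_of_eq ?_)
    (mul_le_mul_right (h (μ⁻¹ * a) (by positivity)) (ENNReal.ofReal (μ ^ (γ + 1))))
  have hμγ : ENNReal.ofReal (μ ^ (γ + 1)) = ENNReal.ofReal μ * ENNReal.ofReal (μ ^ γ) := by
    rw [← ofReal_mul_ofReal_rpow hμ, Real.rpow_one, mul_comm]
  rw [hμγ, mul_assoc _ _ (lintegral _ _)]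
  congr 1
  rw [← lintegral_const_mul' _ _ ENNReal.ofReal_ne_top]
  refine setLIntegral_congr_fun measurableSet_Ioo fun s hs => ?_
  have hs0 : 0 < s := hs.1
  have e : C * μ ^ (1 + γ - 1 / q) * (μ * s) ^ (1 / q) = μ * μ ^ γ * (C * s ^ (1 / q)) := by
    rw [Real.mul_rpow hμ.le hs0.le, Real.rpow_sub hμ, Real.rpow_add hμ, Real.rpow_one]
    field_simp
  simp only [e]
  rw [← ENNReal.ofReal_mul hμ.le, ENNReal.ofReal_mul (p := μ * μ ^ γ) (by positivity),
    ENNReal.mul_div_mul_left _ _ (by simpa using by positivity) ENNReal.ofReal_ne_top,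
    ofReal_rpow_mul hμ hs0]
  ring

theorem scaledBeta_mul_le (h₂ : IsYoungDensity φ₂) {θ : ℝ} (hθ : 0 < θ) (hθ1 : θ ≤ 1) (ε a : ℝ) :
    scaledBeta q γ (complFn φ₂) (θ * ε) a ≤ ENNReal.ofReal θ * scaledBeta q γ (complFn φ₂) ε a := by
  rw [scaledBeta, scaledBeta, ← lintegral_const_mul' _ _ ENNReal.ofReal_ne_top]
  refine lintegral_mono fun s => ?_
  rw [← mul_assoc, mul_assoc θ]
  gcongr
  exact youngFn_mul_le (h₂.genInv_monotone.monotoneOn _) hθ hθ1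

theorem scaledBeta_pos (h₂ : IsYoungDensity φ₂) (hκ : 1 + γ - 1 / q ≠ 0) {ε a : ℝ} (hε : 0 < ε)
    (ha : 0 < a) : 0 < scaledBeta q γ (complFn φ₂) ε a := by
  obtain ⟨μ, hμ, rfl⟩ := exists_rpow_eq hκ hε
  rw [scaledBeta_rpow_eq _ _ _ hμ ha]
  exact ENNReal.mul_pos (ofReal_rpow_pos hμ _).ne' (betaFn_pos h₂ q γ (by positivity)).ne'

/-- Continuity in `ε` comes from that of `β` through `μ`. Convexity, `Ψ(θx) ≤ θΨ(x)`, gives values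
on both sides of `y`, and the intermediate value theorem applies. -/
theorem exists_scaledBeta_eq (h₂ : IsYoungDensity φ₂) (hκ : 1 + γ - 1 / q ≠ 0)
    (hfin : ∀ t, 0 < t → betaFn q γ (complFn φ₂) t < ∞) {a : ℝ} (ha : 0 < a) {y : ℝ≥0∞}
    (hy : 0 < y) (hytop : y ≠ ∞) : ∃ ε, 0 < ε ∧ scaledBeta q γ (complFn φ₂) ε a = y := by
  have hc : ContinuousOn (fun μ : ℝ => scaledBeta q γ (complFn φ₂) (μ ^ (1 + γ - 1 / q)) a)
      (Ioi 0) := by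
    have h1 : ContinuousOn (fun μ : ℝ => ENNReal.ofReal (μ ^ (γ + 1)) *
        betaFn q γ (complFn φ₂) (μ⁻¹ * a)) (Ioi 0) := by
      intro μ hμ
      have hμ0 : 0 < μ := hμ
      refine ContinuousAt.continuousWithinAt ?_
      refine ENNReal.Tendsto.mul ?_ (.inl (ofReal_rpow_pos hμ0 _).ne') ?_
        (.inr ENNReal.ofReal_ne_top)
      · exact ENNReal.tendsto_ofReal (Real.continuousAt_rpow_const _ _ (.inl hμ0.ne'))
      · have h3 : ContinuousAt (betaFn q γ (complFn φ₂)) (μ⁻¹ * a) :=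
          (continuousOn_setLIntegral_Ioi hfin).continuousAt (Ioi_mem_nhds (by positivity))
        exact h3.tendsto.comp ((continuousAt_inv₀ hμ0.ne').mul_const a)
    exact h1.congr fun μ hμ => scaledBeta_rpow_eq _ _ _ hμ ha
  set b := scaledBeta q γ (complFn φ₂) 1 a with hb
  have hbpos : 0 < b := scaledBeta_pos h₂ hκ one_pos ha
  have hbtop : b ≠ ∞ := (scaledBeta_lt_top hκ hfin one_pos ha).ne
  have hratio : ∀ u v : ℝ≥0∞, 0 < u → u ≠ ∞ → v ≠ ∞ → 0 < v →
      ∃ θ : ℝ, 0 < θ ∧ θ ≤ 1 ∧ ENNReal.ofReal θ * u ≤ v := by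
    intro u v hu hu' hv' hv
    refine ⟨min 1 (v / u).toReal, lt_min one_pos (ENNReal.toReal_pos ?_ ?_), min_le_left _ _, ?_⟩
    · exact (ENNReal.div_pos hv.ne' hu').ne'
    · exact (ENNReal.div_lt_top hv' hu.ne').ne
    · calc _ ≤ ENNReal.ofReal (v / u).toReal * u := by gcongr; exact min_le_right _ _
        _ = v := by
          rw [ENNReal.ofReal_toReal (ENNReal.div_lt_top hv' hu.ne').ne,
            ENNReal.div_mul_cancel hu.ne' hu']
  obtain ⟨θ₁, hθ₁, hθ₁1, h1⟩ := hratio b y hbpos hbtop hytop hy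
  obtain ⟨θ₂, hθ₂, hθ₂1, h2⟩ := hratio y b hy hytop hbtop hbpos
  have h1' : scaledBeta q γ (complFn φ₂) θ₁ a ≤ y := by
    have := scaledBeta_mul_le (q := q) (γ := γ) h₂ hθ₁ hθ₁1 1 a
    rw [mul_one] at this
    exact this.trans h1
  have h2' : y ≤ scaledBeta q γ (complFn φ₂) θ₂⁻¹ a := by
    have := scaledBeta_mul_le (q := q) (γ := γ) h₂ hθ₂ hθ₂1 θ₂⁻¹ a
    rw [mul_inv_cancel₀ hθ₂.ne'] at this
    exact (ENNReal.mul_le_mul_iff_right (by simpa using hθ₂) ENNReal.ofReal_ne_top).1 (h2.trans this)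
  obtain ⟨μ₁, hμ₁, e1⟩ := exists_rpow_eq hκ hθ₁
  obtain ⟨μ₂, hμ₂, e2⟩ := exists_rpow_eq hκ (inv_pos.2 hθ₂)
  obtain ⟨μ, hμ, e⟩ := isPreconnected_Ioi.intermediate_value (mem_Ioi.2 hμ₁) (mem_Ioi.2 hμ₂) hc
    (show y ∈ Icc _ _ from ⟨by simpa only [e1] using h1', by simpa only [e2] using h2'⟩)
  exact ⟨_, Real.rpow_pos_of_pos hμ _, e⟩

theorem setLIntegral_le_scaledBeta (h₂ : IsYoungDensity φ₂) {ε a : ℝ} (hε : 0 < ε) (ha : 0 < a)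
    (f : ℝ → ℝ≥0) {S : Set ℝ} (hS : MeasurableSet S) (hSa : S ⊆ Ioi a) :
    ∫⁻ s in S, (f s : ℝ≥0∞) * ENNReal.ofReal (s ^ (1 / q - 1)) ≤ ENNReal.ofReal (2 / ε) *
      ((∫⁻ s in S, youngFn φ₂ (f s) * ENNReal.ofReal (s ^ γ)) +
        scaledBeta q γ (complFn φ₂) (2 * ε) a) := by
  have h1 : ∫⁻ s in S, (f s : ℝ≥0∞) * ENNReal.ofReal (s ^ (1 / q - 1)) ≤ ENNReal.ofReal (2 / ε) *
      ∫⁻ s in S, (youngFn φ₂ (f s) * ENNReal.ofReal (s ^ γ) +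
        complFn φ₂ (ENNReal.ofReal (2 * ε * s ^ (1 / q - 1 - γ))) * ENNReal.ofReal (s ^ γ)) := by
    rw [← lintegral_const_mul' _ _ ENNReal.ofReal_ne_top]
    refine setLIntegral_mono' hS fun s hs => ?_
    have hs0 : 0 < s := ha.trans (hSa hs)
    have hx : 0 < s ^ (1 / q - 1 - γ) := Real.rpow_pos_of_pos hs0 _
    have e : ENNReal.ofReal (s ^ (1 / q - 1)) = ENNReal.ofReal (1 / ε) *
        ENNReal.ofReal (ε * s ^ (1 / q - 1 - γ)) * ENNReal.ofReal (s ^ γ) := by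
      rw [← ENNReal.ofReal_mul (by positivity), ← mul_assoc, one_div_mul_cancel hε.ne', one_mul,
        ofReal_mul_ofReal_rpow hs0]
      ring_nf
    have h2 := h₂.mul_le_two_mul_add (f s) (mul_pos hε hx)
    rw [← mul_assoc 2 ε] at h2
    calc _ = ENNReal.ofReal (1 / ε) * ((f s : ℝ≥0∞) *
          ENNReal.ofReal (ε * s ^ (1 / q - 1 - γ))) * ENNReal.ofReal (s ^ γ) := by rw [e]; ring
      _ ≤ ENNReal.ofReal (1 / ε) * (2 * (youngFn φ₂ (f s) + complFn φ₂
          (ENNReal.ofReal (2 * ε * s ^ (1 / q - 1 - γ))))) * ENNReal.ofReal (s ^ γ) := by gcongr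
      _ = _ := by
        rw [show (2 : ℝ) / ε = 2 * (1 / ε) by ring, ENNReal.ofReal_mul zero_le_two,
          ENNReal.ofReal_ofNat]
        ring
  refine h1.trans ?_
  -- As `f` is arbitrary, additivity rests on measurability of the `Ψ₂` term.
  rw [lintegral_add_right _
    (measurable_betaFn_integrand (Ψ := complFn φ₂) (youngFn_mono _) _ _ _)]
  gcongr
  exact lintegral_mono_set hSa

/-- The modular inequality for a function carried by `(a, ∞)`, with the Hardy operator replaced by
its values on `(0, a)`. -/
theorem setLIntegral_youngFn_div_le {Φ : ℝ≥0∞ → ℝ≥0∞} (hΦ : Monotone Φ) (h₂ : IsYoungDensity φ₂)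
    (hκ : 1 + γ - 1 / q ≠ 0) {C : ℝ} (hC : 0 < C)
    (h : ∀ t, 0 < t → ∫⁻ s in Ioo 0 t, Φ (betaFn q γ (complFn φ₂) t /
      ENNReal.ofReal (C * s ^ (1 / q))) * ENNReal.ofReal (s ^ γ) ≤ betaFn q γ (complFn φ₂) t)
    (hfin : ∀ t, 0 < t → betaFn q γ (complFn φ₂) t < ∞) {a : ℝ} (ha : 0 < a)
    (f : ℝ → ℝ≥0) {S : Set ℝ} (hS : MeasurableSet S) (hSa : S ⊆ Ioi a) :
    ∫⁻ s in Ioo 0 a, Φ ((∫⁻ u in S, (f u : ℝ≥0∞) * ENNReal.ofReal (u ^ (1 / q - 1))) /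
      ENNReal.ofReal (8 * C * s ^ (1 / q))) * ENNReal.ofReal (s ^ γ) ≤
        ∫⁻ s in S, youngFn φ₂ (f s) * ENNReal.ofReal (s ^ γ) := by
  refine le_of_forall_gt_imp_ge_of_dense fun y hy => ?_
  rcases eq_or_ne y ∞ with rfl | hytop
  · exact le_top
  -- This `ε` makes both terms of Young's inequality, used with `ε/2`, at most `y`; hence the
  -- constant `(2/(ε/2))·2 = 8/ε`.
  obtain ⟨ε, hε, hεy⟩ := exists_scaledBeta_eq h₂ hκ hfin ha (pos_of_gt hy) hytop
  have h1 := setLIntegral_le_scaledBeta (q := q) (γ := γ) h₂ (half_pos hε) ha f hS hSa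
  rw [mul_div_cancel₀ _ two_ne_zero, hεy] at h1
  have h2 : ∫⁻ u in S, (f u : ℝ≥0∞) * ENNReal.ofReal (u ^ (1 / q - 1)) ≤
      ENNReal.ofReal (8 / ε) * y := by
    calc _ ≤ ENNReal.ofReal (2 / (ε / 2)) * (y + y) := h1.trans (by gcongr)
      _ = _ := by
        rw [← two_mul, ← mul_assoc, ← ENNReal.ofReal_ofNat 2, ← ENNReal.ofReal_mul (by positivity)]
        congr 2
        field_simp
        norm_num
  have h3 := setLIntegral_youngFn_scaledBeta_le hκ hC h hε ha
  rw [hεy] at h3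
  refine le_trans (setLIntegral_mono' measurableSet_Ioo fun s hs => ?_) h3
  refine mul_le_mul_left (hΦ ?_) _
  have hsa : 0 < s ^ (1 / q) := Real.rpow_pos_of_pos hs.1 _
  have e : ENNReal.ofReal (8 * C * s ^ (1 / q)) =
      ENNReal.ofReal (8 / ε) * ENNReal.ofReal (C * ε * s ^ (1 / q)) := by
    rw [← ENNReal.ofReal_mul (by positivity)]
    congr 1
    field_simp
  rw [e]
  refine (ENNReal.div_le_div_right h2 _).trans_eq ?_
  exact ENNReal.mul_div_mul_left _ _ (by simpa using hε) ENNReal.ofReal_ne_top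

end Scaled

/-! ### Dyadic decomposition and sufficiency. -/

/-- The slice is `(a, b]` with `I(a) = 2v` and `I(b) = v`, so its integral is `2v - v`. -/
theorem exists_slice {h I : ℝ → ℝ≥0∞} (hI : ∀ t, I t = ∫⁻ s in Ioi t, h s)
    (hfin : ∀ t, 0 < t → I t < ∞) {v : ℝ≥0∞} (hv : 0 < v) {t : ℝ} (ht : 0 < t)
    (hvt : 2 * v < I t) :
    ∃ a, 0 < a ∧ (∀ s, 2 * v < I s → s < a) ∧ I ⁻¹' Ico v (2 * v) ⊆ Ioi a ∧
      ∫⁻ s in I ⁻¹' Ico v (2 * v), h s = v := by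
  obtain rfl : I = fun t => ∫⁻ s in Ioi t, h s := funext hI
  set I := fun t => ∫⁻ s in Ioi t, h s
  have hanti : Antitone I := fun _ _ hab => lintegral_mono_set (Ioi_subset_Ioi hab)
  have hc : ContinuousOn I (Ioi 0) := continuousOn_setLIntegral_Ioi hfin
  have h0 : Tendsto I atTop (𝓝 0) := tendsto_setLIntegral_Ioi_atTop (hfin 1 one_pos)
  have hv2 : v ≤ 2 * v := by rw [two_mul]; exact le_self_add
  have hvtop : v ≠ ∞ := ((hv2.trans hvt.le).trans_lt (hfin t ht)).ne
  obtain ⟨a, hta, hav, ha⟩ := exists_level_of_antitone hanti hc h0 (hv.trans_le hv2) ht hvt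
  obtain ⟨b, -, hbv, hb⟩ := exists_level_of_antitone hanti hc h0 hv ht (hv2.trans_lt hvt)
  have hS : I ⁻¹' Ico v (2 * v) = Ioc a b := by
    ext s
    simp only [mem_preimage, mem_Ico, mem_Ioc, hb, ← not_le, ha]
    exact and_comm
  have hab : a ≤ b := (hb a).1 (hav ▸ hv2)
  refine ⟨a, ht.trans hta, fun s hs => lt_of_not_ge fun has => ?_, hS ▸ fun s hs => hs.1, ?_⟩
  · exact ((hanti has).trans_eq hav).not_gt hs
  · have hsplit : I a = (∫⁻ s in Ioc a b, h s) + I b := by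
      simp only [I]
      rw [← Ioc_union_Ioi_eq_Ioi hab, lintegral_union measurableSet_Ioi
        (Ioc_disjoint_Ioi le_rfl)]
    rw [hav, hbv, two_mul] at hsplit
    rw [hS]
    exact ((ENNReal.add_left_inj hvtop).1 hsplit).symm

/-- The constant `32` is `4·8`: 4 from comparing the tail on `D n` with the integral `2^n` over `S
n`, 8 from `setLIntegral_youngFn_div_le`. -/
theorem modular_hardyQ_le {q γ : ℝ} {φ₂ : ℝ → ℝ} {Φ : ℝ≥0∞ → ℝ≥0∞} (hΦ : Monotone Φ)
    (hΦ0 : Φ 0 = 0) (h₂ : IsYoungDensity φ₂) (hκ : 1 + γ - 1 / q ≠ 0) {C : ℝ} (hC : 0 < C)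
    (h : ∀ t, 0 < t → ∫⁻ s in Ioo 0 t, Φ (betaFn q γ (complFn φ₂) t /
      ENNReal.ofReal (C * s ^ (1 / q))) * ENNReal.ofReal (s ^ γ) ≤ betaFn q γ (complFn φ₂) t)
    (hfin : ∀ t, 0 < t → betaFn q γ (complFn φ₂) t < ∞) (g : ℝ → ℝ≥0) :
    modular Φ γ (fun t => hardyQ q g t / ENNReal.ofReal (32 * C)) ≤
      modular (youngFn φ₂) γ (fun s => (g s : ℝ≥0∞)) := by
  rcases eq_or_ne (modular (youngFn φ₂) γ (fun s => (g s : ℝ≥0∞))) ∞ with htop | htop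
  · exact htop ▸ le_top
  set I := hardyTail q g with hI
  have hIfin : ∀ t, 0 < t → I t < ∞ := fun t ht => by
    refine (setLIntegral_le_scaledBeta (γ := γ) h₂ one_pos ht g measurableSet_Ioi
      subset_rfl).trans_lt (ENNReal.mul_lt_top ENNReal.ofReal_lt_top (ENNReal.add_lt_top.2 ⟨?_, ?_⟩))
    · exact (lintegral_mono_set (Ioi_subset_Ioi ht.le)).trans_lt htop.lt_top
    · exact scaledBeta_lt_top hκ hfin (by norm_num) ht
  have hIm : Measurable I := (hardyTail_antitone q g).measurable
  set D : ℤ → Set ℝ := fun n => I ⁻¹' Ioc (2 * 2 ^ n) (4 * 2 ^ n) ∩ Ioi 0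
  set S : ℤ → Set ℝ := fun n => I ⁻¹' Ico (2 ^ n) (2 * 2 ^ n) ∩ Ioi 0 with hS
  have hSm : ∀ n, MeasurableSet (S n) := fun n => (hIm measurableSet_Ico).inter measurableSet_Ioi
  have hsucc : ∀ n : ℤ, (2 : ℝ≥0∞) ^ (n + 1) = 2 * 2 ^ n := fun n => by
    rw [ENNReal.zpow_add two_ne_zero ENNReal.ofNat_ne_top, zpow_one, mul_comm]
  have hSd : Pairwise (Function.onFun Disjoint S) := by
    have hmono : Monotone fun n : ℤ => (2 : ℝ≥0∞) ^ n := fun a b hab =>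
      ENNReal.zpow_le_of_le one_le_two hab
    intro m n hmn
    have := hmono.pairwise_disjoint_on_Ico_succ hmn
    simp only [Function.onFun, Order.succ_eq_add_one, hsucc] at this
    exact (this.preimage I).mono inter_subset_left inter_subset_left
  have hcover : Ioi (0 : ℝ) ⊆ (I ⁻¹' {0} ∩ Ioi 0) ∪ ⋃ n, D n := by
    intro t ht
    rcases eq_or_ne (I t) 0 with h0 | h0
    · exact .inl ⟨h0, ht⟩
    · obtain ⟨m, hm⟩ := ENNReal.exists_mem_Ioc_zpow h0 (hIfin t ht).ne
        ENNReal.one_lt_two ENNReal.ofNat_ne_top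
      -- The shift is needed because `D n` is the level band `(2^(n+1), 2^(n+2)]`.
      refine .inr (mem_iUnion.2 ⟨m - 1, ?_, ht⟩)
      have e1 := hsucc (m - 1)
      have e2 := hsucc m
      rw [sub_add_cancel] at e1
      rw [mem_preimage, ← e1, show (4 : ℝ≥0∞) = 2 * 2 by norm_num, mul_assoc, ← e1, ← e2]
      exact hm
  have hD : ∀ n, ∫⁻ t in D n, Φ (hardyQ q g t / ENNReal.ofReal (32 * C)) * ENNReal.ofReal (t ^ γ) ≤
      ∫⁻ s in S n, youngFn φ₂ (g s) * ENNReal.ofReal (s ^ γ) := by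
    intro n
    rcases (D n).eq_empty_or_nonempty with hDn | ⟨t, ht, ht0⟩
    · simp [hDn]
    have hv : (0 : ℝ≥0∞) < 2 ^ n := ENNReal.zpow_pos two_ne_zero ENNReal.ofNat_ne_top n
    obtain ⟨a, ha, hlt, hSa, hE⟩ := exists_slice (I := I) (fun _ => rfl) hIfin hv ht0 ht.1
    have hSeq : S n = I ⁻¹' Ico (2 ^ n) (2 * 2 ^ n) :=
      inter_eq_left.2 (hSa.trans (Ioi_subset_Ioi ha.le))
    have hmain := setLIntegral_youngFn_div_le hΦ h₂ hκ hC h hfin ha g (hSm n) (hSeq ▸ hSa)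
    rw [hSeq] at hmain ⊢
    rw [hE] at hmain
    refine le_trans ?_ hmain
    have hsub : D n ⊆ Ioo 0 a := fun s hs => ⟨hs.2, hlt s hs.1.1⟩
    refine le_trans (setLIntegral_mono' ((hIm measurableSet_Ioc).inter measurableSet_Ioi)
      fun s hs => ?_) (lintegral_mono_set hsub)
    refine mul_le_mul_left (hΦ ?_) _
    have hs0 : 0 < s := hs.2
    have hsa : 0 < s ^ (1 / q) := Real.rpow_pos_of_pos hs0 _
    calc hardyQ q g s / ENNReal.ofReal (32 * C)
        ≤ ENNReal.ofReal (s ^ (-(1 / q))) * (4 * 2 ^ n) / ENNReal.ofReal (32 * C) := by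
          rw [hardyQ_eq]
          gcongr
          exact hs.1.2
      _ = 2 ^ n * (ENNReal.ofReal (s ^ (-(1 / q))) * ENNReal.ofReal 4 *
          ENNReal.ofReal (32 * C)⁻¹) := by
          rw [div_eq_mul_inv, ENNReal.ofReal_inv_of_pos (by positivity), ENNReal.ofReal_ofNat]
          ring
      _ = 2 ^ n / ENNReal.ofReal (8 * C * s ^ (1 / q)) := by
          rw [← ENNReal.ofReal_mul (by positivity), ← ENNReal.ofReal_mul (by positivity),
            div_eq_mul_inv (2 ^ n : ℝ≥0∞), ← ENNReal.ofReal_inv_of_pos (by positivity), Real.rpow_neg hs0.le]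
          congr 2
          field_simp
          norm_num
  calc modular Φ γ (fun t => hardyQ q g t / ENNReal.ofReal (32 * C))
      ≤ ∫⁻ t in (I ⁻¹' {0} ∩ Ioi 0) ∪ ⋃ n, D n,
          Φ (hardyQ q g t / ENNReal.ofReal (32 * C)) * ENNReal.ofReal (t ^ γ) :=
        lintegral_mono_set hcover
    _ ≤ 0 + ∑' n, ∫⁻ s in S n, youngFn φ₂ (g s) * ENNReal.ofReal (s ^ γ) := by
        refine (lintegral_union_le _ _ _).trans (add_le_add (le_of_eq ?_)
          ((lintegral_iUnion_le _ _).trans (ENNReal.tsum_le_tsum hD)))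
        refine setLIntegral_eq_zero ((hIm (measurableSet_singleton 0)).inter measurableSet_Ioi)
          fun t ht => ?_
        have h0 : hardyTail q g t = 0 := ht.1
        simp [hardyQ_eq, h0, hΦ0]
    _ = ∫⁻ s in ⋃ n, S n, youngFn φ₂ (g s) * ENNReal.ofReal (s ^ γ) := by
        rw [zero_add, lintegral_iUnion hSm hSd]
    _ ≤ _ := lintegral_mono_set (iUnion_subset fun n => inter_subset_right)

theorem betaFn_eq_top {q γ : ℝ} {φ : ℝ → ℝ} (h : IsYoungDensity φ) (hκ : 1 + γ - 1 / q = 0)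
    (hγ : -1 ≤ γ) {t : ℝ} (ht : 0 < t) : betaFn q γ (complFn φ) t = ∞ := by
  have e : 1 / q - 1 - γ = 0 := by linarith
  have hint : ∫⁻ s in Ioi t, ENNReal.ofReal (s ^ γ) = ∞ := by
    by_contra hne
    have : IntegrableOn (fun s : ℝ => s ^ γ) (Ioi t) := by
      refine ⟨(measurable_id.pow_const γ).aestronglyMeasurable, ?_⟩
      refine lt_of_eq_of_lt ?_ (lt_top_iff_ne_top.2 hne)
      exact setLIntegral_congr_fun measurableSet_Ioi fun s hs =>
        enorm_ofReal_rpow (ht.trans (mem_Ioi.1 hs)) γ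
    exact hγ.not_gt ((integrableOn_Ioi_rpow_iff ht).1 this)
  rw [betaFn]
  simp only [e, Real.rpow_zero]
  rw [lintegral_const_mul _ (measurable_ofReal_rpow γ), hint,
    ENNReal.mul_top (h.complFn_pos one_pos).ne']

theorem BKCond.modularIneq {q γ : ℝ} (hq : q ≠ 0) (hqγ : q < 0 → 1 / q ≠ γ + 1)
    {Φ : ℝ≥0∞ → ℝ≥0∞} (hΦ : Monotone Φ) (hΦ0 : Φ 0 = 0) {φ₂ : ℝ → ℝ} (h₂ : IsYoungDensity φ₂)
    (h : BKCond q γ Φ (complFn φ₂)) : ModularIneq q γ Φ (youngFn φ₂) := by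
  obtain ⟨C, hC, h⟩ := h
  have hκ : 1 + γ - 1 / q ≠ 0 := by
    -- In the critical case `1/q = γ + 1`, the hypothesis on negative `q` forces `q > 0`. Then `γ >
    -- -1` and `β = Ψ₂(1) ∫ s^γ` diverges, against its finiteness.
    intro hκ
    have hq0 : 0 < q := lt_of_le_of_ne (not_lt.1 fun hlt => hqγ hlt (by linarith)) hq.symm
    have : 0 < 1 / q := by positivity
    exact (h 1 one_pos).2.ne (betaFn_eq_top h₂ hκ (by linarith) one_pos)
  refine ⟨32 * C, by positivity, fun f _ => ?_⟩
  have hK : 0 < 32 * C := by positivity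
  have hmain := modular_hardyQ_le hΦ hΦ0 h₂ hκ hC (fun t ht => (h t ht).1) (fun t ht => (h t ht).2)
    (fun s => (32 * C).toNNReal * f s)
  refine le_trans (modular_mono hΦ γ fun t _ => ?_) hmain
  rw [hardyQ_const_mul]
  exact (ENNReal.eq_div_iff (by simpa using hC) ENNReal.ofReal_ne_top).2 rfl |>.le

theorem mainTheorem5 (q γ : ℝ) (hq : q ≠ 0) (hγ : γ ≠ -1)
    (hqγ : q < 0 → 1 / q ≠ γ + 1)
    (φ₁ φ₂ : ℝ → ℝ) (hφ₁ : IsYoungDensity φ₁) (hφ₂ : IsYoungDensity φ₂) :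
    List.TFAE
      [GaugeIneq q γ (youngFn φ₁) (youngFn φ₂),
       ModularIneq q γ (youngFn φ₁) (youngFn φ₂),
       ContinuousMapping q γ (youngFn φ₁) (youngFn φ₂),
       BKCond q γ (youngFn φ₁) (complFn φ₂),
       BKCond' q γ φ₁ (complFn φ₂)] := by
  tfae_have 1 → 2 := GaugeIneq.modularIneq hγ (youngFn_mono φ₁)
  tfae_have 2 → 1 := ModularIneq.gaugeIneq
  tfae_have 2 → 3 := ModularIneq.continuousMapping (youngFn_mono φ₁) hφ₁.youngFn_top
  tfae_have 3 → 2 := ContinuousMapping.modularIneq hγ (youngFn_mono φ₁) (youngFn_zero φ₂)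
  tfae_have 2 → 4 := ModularIneq.bkCond hφ₁ hφ₂
  tfae_have 4 → 2 := BKCond.modularIneq hq hqγ (youngFn_mono φ₁) (youngFn_zero φ₁) hφ₂
  tfae_have 4 → 5 := bkCond'_of_bkCond hφ₁ hφ₂
  tfae_have 5 → 4 := bkCond_of_bkCond' hφ₁
  tfae_finish
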